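/- **Setting.** Let $(\mathcal Z,\mathscr Z)$ be a measurable space, let $Z_1,Z_2,\ldots$ be $\mathcal Z$-valued random variables on a common probability space, and let $P_t$ be the law of $Z_t$. Let $\mathcal F$ be a class of measurable functions $f:\mathcal Z\to[0,1]$ of finite pseudo-dimension; that is, there is a largest $k\ge 0$ for which some $(z_1,w_1),\ldots,(z_k,w_k)\in\mathcal Z\times\mathbb R$ satisfy $|\{(\mathbf 1[f(z_1)\le w_1],\ldots,\mathbf 1[f(z_k)\le w_k]) : f\in\mathcal F\}|=2^k$. To avoid measurability problems, assume that for all $n$, all times $t_1,\ldots,t_n\ge 1$ and all signs $e_1,\ldots,e_n\in\{-1,1\}$, the map $(z_1,\ldots,z_n)\mapsto\sup_{f\in\mathcal F}\left|\sum_{i=1}^n e_i f(z_i)\right|$ is measurable with respect to the completion of $P_{t_1}\times\cdots\times P_{t_n}$ (this is automatic if $\mathcal F$ is countable). For $k\ge1$ let $$\beta_k=\tfrac12\sup\Big\{\sum_{i=1}^I\sum_{j=1}^J|\mathbb P(A_i\cap B_j)-\mathbb P(A_i)\mathbb P(B_j)|\Big\},$$ where the supremum is over all $\ell\ge1$, all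 finite partitions $\{A_i\}$ of the sample space into sets of $\sigma(Z_1,\ldots,Z_\ell)$, and all finite partitions $\{B_j\}$ into sets of $\sigma(Z_{\ell+k},Z_{\ell+k+1},\ldots)$. Let $\rho(P,Q)=\sup_{f\in\mathcal F}\left|\mathbb E_P f-\mathbb E_Q f\right|$, let $\Delta_1=0$, and for $t\ge2$ let $\Delta_t\in[0,1]$ satisfy $\rho(P_t,P_{t-1})\le\Delta_t$. Fix $\alpha\in[0,1)$ and $r\in(0,\infty)$, and for $t\ge 2$ put $$k_t=\min\Big\{\Big\lceil t^{(1-\alpha)\frac{3}{3+4r}}\Big\rceil,\;t-1\Big\},\qquad m_t=\min\Big\{\Big\lceil t^{(1-\alpha)\frac{3+2r}{3+4r}}\Big\rceil,\;t-1\Big\}.$$ Let $\hat f_1\in\mathcal F$ be arbitrary, and for each $t\ge2$ let $\hat f_t\in\mathcal F$ be a minimizer (assumed to exist) over $f\in\mathcal F$ of $\sum_{s=1}^{\lfloor m_t/k_t\rfloor}f(Z_{t-sk_t})$, chosen as a function of $Z_1,\ldots,Z_{t-k_t}$ in such a way that $(\omega,z)\mapsto\hat f_t(\omega)(z)$ is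 measurable with respect to $\sigma(Z_1,\ldots,Z_{t-k_t})\otimes\mathscr Z$. **Theorem.** If $\sum_{t=1}^T\Delta_t=O(T^\alpha)$ as $T\to\infty$ and $\beta_k=O(k^{-r})$ as $k\to\infty$, then, as $T\to\infty$, $$\sum_{t=1}^T\mathbb E\big[\hat f_t(Z_t)\big]-\sum_{t=1}^T\inf_{f\in\mathcal F}\mathbb E\big[f(Z_t)\big]=O\Big(T^{\alpha+(1-\alpha)\frac{3+3r}{3+4r}}\Big),$$ and the right-hand side is sublinear: $T^{\alpha+(1-\alpha)\frac{3+3r}{3+4r}}=o(T)$. -/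

import Mathlib

open MeasureTheory Filter Asymptotics

noncomputable section

namespace DriftLearning

variable {Ω 𝒵 : Type*}

/-- The pseudo-dimension of a class `F` of real functions: the largest `k` for which there are
points `z₁, …, z_k` and thresholds `w₁, …, w_k` such that the sign patterns
`(𝟙[f z₁ ≤ w₁], …, 𝟙[f z_k ≤ w_k])`, `f ∈ F`, take all `2 ^ k` values
(`⊤` if there are arbitrarily large such `k`). -/
def pseudoDim (F : Set (𝒵 → ℝ)) : ℕ∞ :=
  sSup {d : ℕ∞ | ∃ k : ℕ, d = k ∧ ∃ (z : Fin k → 𝒵) (w : Fin k → ℝ),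
    Set.ncard {p : Fin k → Prop | ∃ f ∈ F, p = fun i => f (z i) ≤ w i} = 2 ^ k}

/-- The discrepancy `ρ(P, Q) = sup_{f ∈ F} |E_P f - E_Q f|`. -/
def discrepancy [MeasurableSpace 𝒵] (F : Set (𝒵 → ℝ)) (P Q : Measure 𝒵) : ℝ :=
  ⨆ f : F, |(∫ z, f.1 z ∂P) - ∫ z, f.1 z ∂Q|

/-- The σ-algebra on `Ω` generated by the variables `Z i`, `i ∈ S`. -/
@[reducible] def sigmaGen [MeasurableSpace 𝒵] (Z : ℕ → Ω → 𝒵) (S : Set ℕ) : MeasurableSpace Ω :=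
  ⨆ i ∈ S, MeasurableSpace.comap (Z i) inferInstance

/-- `A₁, …, A_I` is a finite partition of `Ω` into `m`-measurable sets. -/
structure IsFinPartition (m : MeasurableSpace Ω) {I : ℕ} (A : Fin I → Set Ω) : Prop where
  measurable : ∀ i, MeasurableSet[m] (A i)
  disjoint : Pairwise fun i j => Disjoint (A i) (A j)
  cover : ⋃ i, A i = Set.univ

/-- The `k`-th β-mixing coefficient of the process `Z 1, Z 2, …` (the value `Z 0` plays no role). -/
def betaMix [MeasurableSpace Ω] [MeasurableSpace 𝒵] (μ : Measure Ω) (Z : ℕ → Ω → 𝒵) (k : ℕ) : ℝ :=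
  (1 / 2) * sSup {x : ℝ | ∃ ℓ : ℕ, 1 ≤ ℓ ∧
    ∃ (I J : ℕ) (A : Fin I → Set Ω) (B : Fin J → Set Ω),
      IsFinPartition (sigmaGen Z (Set.Icc 1 ℓ)) A ∧
      IsFinPartition (sigmaGen Z (Set.Ici (ℓ + k))) B ∧
      x = ∑ i, ∑ j, |μ.real (A i ∩ B j) - μ.real (A i) * μ.real (B j)|}

/-- `k_t = ⌈t ^ ((1 - α) * 3 / (3 + 4 r))⌉ ∧ (t - 1)`. -/
def gap (α r : ℝ) (t : ℕ) : ℕ :=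
  min ⌈(t : ℝ) ^ ((1 - α) * (3 / (3 + 4 * r)))⌉₊ (t - 1)

/-- `m_t = ⌈t ^ ((1 - α) * (3 + 2 r) / (3 + 4 r))⌉ ∧ (t - 1)`. -/
def window (α r : ℝ) (t : ℕ) : ℕ :=
  min ⌈(t : ℝ) ^ ((1 - α) * ((3 + 2 * r) / (3 + 4 * r)))⌉₊ (t - 1)

/-- The empirical loss `∑_{s = 1}^{⌊m_t / k_t⌋} f (Z_{t - s k_t})` of `f` on the subsampled recent
history at time `t`. For `t ≥ 2` one has `1 ≤ k_t ≤ m_t ≤ t - 1`, so no subtraction truncates. -/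
def empLoss (α r : ℝ) (Z : ℕ → Ω → 𝒵) (t : ℕ) (ω : Ω) (f : 𝒵 → ℝ) : ℝ :=
  ∑ s ∈ Finset.Icc 1 (window α r t / gap α r t), f (Z (t - s * gap α r t) ω)

/-- `fhat t ω` is the function chosen at time `t` by empirical risk minimization over the subsampled
recent history: at time `1` it is an arbitrary fixed element of `F`; at a time `t ≥ 2` it is a
minimizer over `F` of the empirical loss, chosen as a (measurable) function of the data
`Z 1, …, Z (t - k_t)`. -/
structure IsERM [MeasurableSpace 𝒵] (F : Set (𝒵 → ℝ)) (α r : ℝ) (Z : ℕ → Ω → 𝒵)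
    (fhat : ℕ → Ω → 𝒵 → ℝ) : Prop where
  init : ∃ f ∈ F, ∀ ω, fhat 1 ω = f
  mem : ∀ t, 2 ≤ t → ∀ ω, fhat t ω ∈ F
  isMin : ∀ t, 2 ≤ t → ∀ ω, ∀ g ∈ F, empLoss α r Z t ω (fhat t ω) ≤ empLoss α r Z t ω g
  measurable : ∀ t, 2 ≤ t →
    @Measurable (Ω × 𝒵) ℝ
      (@Prod.instMeasurableSpace Ω 𝒵 (sigmaGen Z (Set.Icc 1 (t - gap α r t))) inferInstance)
      inferInstance (fun p => fhat t p.1 p.2)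

/-- `F` is a measurable class for the measures `P 1, P 2, …`, as usual in empirical process theory:
the signed empirical suprema `sup_{f ∈ F} |∑ i, ± f (z i)|` are measurable with respect to the
completion of each finite product of these measures. Every countable class of measurable functions
with values in `[0, 1]` has this property. -/
def IsMeasurableClass [MeasurableSpace 𝒵] (F : Set (𝒵 → ℝ)) (P : ℕ → Measure 𝒵) : Prop :=
  ∀ (n : ℕ) (τ : Fin n → ℕ) (e : Fin n → ℝ), (∀ i, 1 ≤ τ i) → (∀ i, e i = 1 ∨ e i = -1) →
    AEMeasurable (fun z : Fin n → 𝒵 => ⨆ f : F, |∑ i, e i * f.1 (z i)|)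
      (Measure.pi fun i => P (τ i))

end DriftLearning

end

/-!
At each time `t` the excess risk of the empirical risk minimizer is bounded by four terms, with
`k` the gap, `m` the window and `M = ⌊m / k⌋` the number of subsampled observations
(`abs_excess_risk_le`). Replacing `Z t` by an independent copy costs `β_k`, as the minimizer depends
on the data up to time `t - k` only. Replacing the law of `Z t` by those of the observations in the
window costs the drift over the window, once for the minimizer and once for its competitor. What is
left is the generalization error of the minimizer on the `M` observations, which is of the order
`1 / √M + M β_k`. With the given `k` and `m`, the first, third and fourth terms are `O(t ^ (-κ))`,
`κ = (1 - α) r / (3 + 4 r)` (`error_terms_le`), and the drifts over the windows add up to at most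
the largest window times the total drift, which is of smaller order; summation over `t` gives
`T ^ (1 - κ)`, the claimed rate. The excess risk is not bounded below by `0`, as `Z t` depends on
the data, but it is at least `-β_k`.

The generalization error carries no logarithmic factor, which the rate could not absorb.

* For independent observations, symmetrization (`integral_ghostSup_le`) reduces it to Rademacher
  averages. By the layer cake formula these are at most the averages over the superlevel sets
  `{f > w}` at a fixed level `w` (`sum_abs_rademacher_class_le`), set systems whose
  Vapnik–Chervonenkis dimension is at most the pseudo-dimension. For such a set system, random
  sampling and the Sauer–Shelah lemma bound the packing numbers polynomially (`log_packing_le`),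
  and chaining gives the bound `C √M` (`sum_abs_rademacher_sets_le`).
* For mixing observations, the dependence coefficient, defined through finite partitions, bounds
  the distance of joint laws from product laws on all measurable sets by density of finite unions
  of rectangles (`joint_le_prod_add`). Splitting off the observations one at a time, the joint law
  of `M` observations is within `M β_k` of the product law (`law_le_pi_add_betaMix`).

Only the law of independent observations is covered by the measurability assumption on the suprema;
a measurable majorant carries the bound over to the joint law (`integral_generalization_le`).

A finite maximum inside an expectation over signs `e` is written throughout as the average of the
values at an arbitrary selection of a maximizer for each `e`.
-/

namespace DriftLearning

/-! ### Rademacher sums and a maximal inequality -/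

/-- The real sign encoded by a Boolean: `true ↦ 1`, `false ↦ -1`. -/
def sgn (b : Bool) : ℝ := if b then 1 else -1

lemma abs_sgn (b : Bool) : |sgn b| = 1 := by cases b <;> simp [sgn]

section Rademacher

variable {ι : Type*} [Fintype ι] [DecidableEq ι]

lemma sum_exp_rademacher_le (a : ι → ℝ) (l : ℝ) :
    ∑ e : ι → Bool, Real.exp (l * ∑ i, sgn (e i) * a i)
      ≤ 2 ^ Fintype.card ι * Real.exp (l ^ 2 * (∑ i, a i ^ 2) / 2) := by
  have h1 : ∑ e : ι → Bool, Real.exp (l * ∑ i, sgn (e i) * a i)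
      = ∏ i, ∑ b : Bool, Real.exp (l * (sgn b * a i)) := by
    rw [Finset.prod_univ_sum, Fintype.piFinset_univ]
    exact Finset.sum_congr rfl fun e _ => by rw [Finset.mul_sum, Real.exp_sum]
  have h2 : ∀ i, ∑ b : Bool, Real.exp (l * (sgn b * a i)) ≤ 2 * Real.exp (l ^ 2 * a i ^ 2 / 2) := by
    intro i
    have := Real.cosh_le_exp_half_sq (l * a i)
    rw [Real.cosh_eq] at this
    simp only [Fintype.sum_bool, sgn]
    simp only [if_true, Bool.false_eq_true, if_false, one_mul, neg_mul, mul_neg]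
    rw [mul_pow] at this
    linarith
  rw [h1]
  calc _ ≤ ∏ i, (2 * Real.exp (l ^ 2 * a i ^ 2 / 2)) :=
        Finset.prod_le_prod (fun i _ => Finset.sum_nonneg fun b _ => (Real.exp_pos _).le)
          fun i _ => h2 i
    _ = _ := by
        rw [Finset.prod_mul_distrib, Finset.prod_const, Finset.card_univ, ← Real.exp_sum,
          Finset.mul_sum, Finset.sum_div]

/-- The maximal inequality for finitely many Rademacher sums. The maximum over the family is
expressed by a selection `c` of a member of the family for each sign pattern. -/
lemma sum_abs_rademacher_le {κ : Type*} (S : Finset κ) (a : κ → ι → ℝ) (v : ℝ)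
    (hv : ∀ k ∈ S, ∑ i, a k i ^ 2 ≤ v) (c : (ι → Bool) → κ) (hc : ∀ e, c e ∈ S)
    {l : ℝ} (hl : 0 < l) :
    ∑ e : ι → Bool, |∑ i, sgn (e i) * a (c e) i|
      ≤ 2 ^ Fintype.card ι * ((Real.log (2 * S.card) + l ^ 2 * v / 2) / l) := by
  have hS : (0 : ℝ) < S.card := by
    exact_mod_cast Finset.card_pos.2 ⟨_, hc fun _ => true⟩
  set K : ℝ := 2 * S.card * Real.exp (l ^ 2 * v / 2) with hK
  have hK0 : 0 < K := by positivity
  have hlogK : Real.log K = Real.log (2 * S.card) + l ^ 2 * v / 2 := by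
    rw [hK, Real.log_mul (by positivity) (by positivity), Real.log_exp]
  -- the tangent line of the logarithm at `K`
  have hpt : ∀ x : ℝ, l * |x| ≤ (Real.exp (l * x) + Real.exp (-l * x)) / K + Real.log K - 1 := by
    intro x
    have h1 := Real.log_le_sub_one_of_pos (div_pos (Real.exp_pos (l * |x|)) hK0)
    rw [Real.log_div (Real.exp_pos _).ne' hK0.ne', Real.log_exp] at h1
    have h2 : Real.exp (l * |x|) ≤ Real.exp (l * x) + Real.exp (-l * x) := by
      rcases abs_choice x with h | h <;> rw [h]
      · linarith [Real.exp_pos (-l * x)]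
      · have : l * -x = -l * x := by ring
        rw [this]
        linarith [Real.exp_pos (l * x)]
    have h3 := div_le_div_of_nonneg_right h2 hK0.le
    linarith
  have hexp : ∀ l' : ℝ, l' ^ 2 = l ^ 2 →
      ∑ e : ι → Bool, Real.exp (l' * ∑ i, sgn (e i) * a (c e) i)
        ≤ 2 ^ Fintype.card ι * (K / 2) := by
    intro l' hl'
    calc _ ≤ ∑ e : ι → Bool, ∑ k ∈ S, Real.exp (l' * ∑ i, sgn (e i) * a k i) :=
          Finset.sum_le_sum fun e _ => Finset.single_le_sum
            (f := fun k => Real.exp (l' * ∑ i, sgn (e i) * a k i))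
            (fun _ _ => (Real.exp_pos _).le) (hc e)
      _ = ∑ k ∈ S, ∑ e : ι → Bool, Real.exp (l' * ∑ i, sgn (e i) * a k i) := Finset.sum_comm
      _ ≤ ∑ k ∈ S, 2 ^ Fintype.card ι * Real.exp (l ^ 2 * v / 2) := by
          refine Finset.sum_le_sum fun k hk => (sum_exp_rademacher_le (a k) l').trans ?_
          rw [hl']
          have := hv k hk
          gcongr
      _ = _ := by rw [Finset.sum_const, nsmul_eq_mul, hK]; ring
  have hsum : l * ∑ e : ι → Bool, |∑ i, sgn (e i) * a (c e) i|
      ≤ 2 ^ Fintype.card ι * Real.log K := by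
    rw [Finset.mul_sum]
    calc _ ≤ ∑ e : ι → Bool, ((Real.exp (l * ∑ i, sgn (e i) * a (c e) i)
              + Real.exp (-l * ∑ i, sgn (e i) * a (c e) i)) / K + (Real.log K - 1)) :=
          Finset.sum_le_sum fun e _ => by linarith [hpt (∑ i, sgn (e i) * a (c e) i)]
      _ ≤ 2 ^ Fintype.card ι + 2 ^ Fintype.card ι * (Real.log K - 1) := by
          rw [Finset.sum_add_distrib, ← Finset.sum_div, Finset.sum_add_distrib, Finset.sum_const,
            nsmul_eq_mul]
          have h1 := hexp l rfl
          have h2 := hexp (-l) (by ring)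
          have h3 : (((Finset.univ : Finset (ι → Bool)).card : ℕ) : ℝ) = 2 ^ Fintype.card ι := by
            simp
          rw [h3]
          gcongr
          rw [div_le_iff₀ hK0]
          linarith
      _ = _ := by ring
  rw [← hlogK, ← mul_div_assoc, le_div_iff₀ hl]
  linarith

end Rademacher

/-! ### Packing numbers of set systems of bounded Vapnik–Chervonenkis dimension -/

lemma sum_range_choose_le (m d : ℕ) :
    ∑ k ∈ Finset.range (d + 1), m.choose k ≤ (m + 1) ^ d := by
  rw [add_pow]
  refine Finset.sum_le_sum fun k hk => ?_
  have h1 : 1 ≤ d.choose k := Nat.choose_pos (by simpa [Nat.lt_succ_iff] using hk)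
  simp only [one_pow, mul_one]
  exact (Nat.choose_le_pow m k).trans (Nat.le_mul_of_pos_right _ h1)

lemma card_powerset_filter_le {ι : Type*} (S : Finset ι) (d : ℕ) :
    (S.powerset.filter fun t => t.card ≤ d).card ≤ (S.card + 1) ^ d := by
  classical
  refine le_trans ?_ (sum_range_choose_le S.card d)
  have : S.powerset.filter (fun t => t.card ≤ d)
      ⊆ (Finset.range (d + 1)).biUnion fun k => S.powersetCard k := by
    intro t ht
    simp only [Finset.mem_filter, Finset.mem_powerset] at ht
    simp only [Finset.mem_biUnion, Finset.mem_range, Finset.mem_powersetCard]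
    exact ⟨t.card, by omega, ht.1, rfl⟩
  refine (Finset.card_le_card this).trans (Finset.card_biUnion_le.trans ?_)
  simp [Finset.card_powersetCard]

/-- A set system of dimension at most `d` whose members are distinguished by their traces on `S`
has at most `(|S| + 1) ^ d` members: the Sauer–Shelah lemma for the traces. -/
lemma card_le_of_injOn_trace {ι : Type*} [DecidableEq ι] (𝒜 : Finset (Finset ι)) (d : ℕ)
    (hd : ∀ t, 𝒜.Shatters t → t.card ≤ d) (S : Finset ι)
    (hS : Set.InjOn (fun A : Finset ι => A ∩ S) 𝒜) : 𝒜.card ≤ (S.card + 1) ^ d := by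
  have h1 : (𝒜.image fun A => A ∩ S).card = 𝒜.card := Finset.card_image_of_injOn hS
  rw [← h1]
  refine (Finset.card_le_card_shatterer _).trans
    ((Finset.card_le_card ?_).trans (card_powerset_filter_le S d))
  intro t ht
  rw [Finset.mem_shatterer] at ht
  have htS : t ⊆ S := by
    obtain ⟨u, hu, htu⟩ := ht.exists_superset
    obtain ⟨A, -, rfl⟩ := Finset.mem_image.1 hu
    exact htu.trans Finset.inter_subset_right
  refine Finset.mem_filter.2 ⟨Finset.mem_powerset.2 htS, hd t fun s hs => ?_⟩
  obtain ⟨u, hu, htu⟩ := ht hs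
  obtain ⟨A, hA, rfl⟩ := Finset.mem_image.1 hu
  refine ⟨A, hA, ?_⟩
  rw [← htu, ← Finset.inter_assoc, Finset.inter_right_comm, Finset.inter_eq_left.2 htS]

/-- If distinct members of `𝒜` differ on more than a fraction `1 / q` of the ground set, then some
`m` sample points distinguish all members of `𝒜`, provided that the union bound over all pairs
leaves room. -/
lemma exists_sample_injOn_trace {ι : Type*} [Fintype ι] [DecidableEq ι]
    (𝒜 : Finset (Finset ι)) (h2 : 2 ≤ 𝒜.card) (q : ℝ) (hq : 1 ≤ q)
    (hsep : ∀ A ∈ 𝒜, ∀ B ∈ 𝒜, A ≠ B → (Fintype.card ι : ℝ) < q * (symmDiff A B).card)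
    (m : ℕ) (hm : (𝒜.card : ℝ) ^ 2 * (1 - 1 / q) ^ m < 1) :
    ∃ S : Finset ι, S.card ≤ m ∧ Set.InjOn (fun A : Finset ι => A ∩ S) 𝒜 := by
  set n := Fintype.card ι with hn
  have hq0 : 0 < q := by linarith
  have hn0 : 0 < n := by
    obtain ⟨A, hA, B, hB, hAB⟩ := Finset.one_lt_card.1 h2
    have h1 := hsep A hA B hB hAB
    by_contra h
    have hn' : n = 0 := by omega
    have : (symmDiff A B).card ≤ n := Finset.card_le_univ _
    have h3 : (symmDiff A B).card = 0 := by omega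
    rw [h3, hn'] at h1
    simp at h1
  set bad : Finset (Fin m → ι) := 𝒜.offDiag.biUnion fun p =>
    Fintype.piFinset fun _ : Fin m => (symmDiff p.1 p.2)ᶜ with hbad
  have hcard : (bad.card : ℝ) < (Finset.univ : Finset (Fin m → ι)).card := by
    have h1 : (bad.card : ℝ) ≤ ∑ p ∈ 𝒜.offDiag,
        ((Fintype.piFinset fun _ : Fin m => (symmDiff p.1 p.2)ᶜ).card : ℝ) := by
      exact_mod_cast Finset.card_biUnion_le
    have h3 : ∀ p ∈ 𝒜.offDiag,
        ((Fintype.piFinset fun _ : Fin m => (symmDiff p.1 p.2)ᶜ).card : ℝ)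
          ≤ (n : ℝ) ^ m * (1 - 1 / q) ^ m := by
      rintro ⟨A, B⟩ hp
      rw [Finset.mem_offDiag] at hp
      have := hsep A hp.1 B hp.2.1 hp.2.2
      rw [Fintype.card_piFinset, Finset.prod_const, Finset.card_univ, Fintype.card_fin,
        ← mul_pow, Nat.cast_pow]
      have h4 : (((symmDiff A B)ᶜ.card : ℕ) : ℝ) = n - (symmDiff A B).card := by
        rw [Finset.card_compl, Nat.cast_sub (Finset.card_le_univ _)]
      have h5 : (n : ℝ) / q ≤ (symmDiff A B).card := by
        rw [div_le_iff₀ hq0]; linarith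
      refine pow_le_pow_left₀ (Nat.cast_nonneg _) ?_ m
      rw [h4, mul_sub, mul_one, mul_one_div]
      linarith
    have h4 : (0 : ℝ) ≤ 1 - 1 / q := by
      rw [sub_nonneg, div_le_one hq0]; exact hq
    have h5 : (𝒜.offDiag.card : ℝ) ≤ (𝒜.card : ℝ) ^ 2 := by
      rw [Finset.offDiag_card, sq]
      exact_mod_cast Nat.sub_le _ _
    have h6 : (0 : ℝ) < (n : ℝ) ^ m := by positivity
    calc (bad.card : ℝ) ≤ _ := h1
      _ ≤ 𝒜.offDiag.card * ((n : ℝ) ^ m * (1 - 1 / q) ^ m) := by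
          rw [← nsmul_eq_mul]; exact Finset.sum_le_card_nsmul _ _ _ h3
      _ ≤ (𝒜.card : ℝ) ^ 2 * ((n : ℝ) ^ m * (1 - 1 / q) ^ m) := by gcongr
      _ = (n : ℝ) ^ m * ((𝒜.card : ℝ) ^ 2 * (1 - 1 / q) ^ m) := by ring
      _ < (n : ℝ) ^ m * 1 := by gcongr
      _ = _ := by simp [hn]
  obtain ⟨φ, -, hφ⟩ := Finset.exists_mem_notMem_of_card_lt_card (by exact_mod_cast hcard)
  refine ⟨Finset.univ.image φ, Finset.card_image_le.trans (by simp), ?_⟩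
  intro A hA B hB hAB
  by_contra hne
  apply hφ
  rw [hbad, Finset.mem_biUnion]
  refine ⟨(A, B), Finset.mem_offDiag.2 ⟨hA, hB, hne⟩, ?_⟩
  rw [Fintype.mem_piFinset]
  intro i
  rw [Finset.mem_compl, Finset.mem_symmDiff]
  have h1 := Finset.ext_iff.1 hAB (φ i)
  simp only [Finset.mem_inter, Finset.mem_image, Finset.mem_univ, true_and, exists_apply_eq_apply,
    and_true] at h1
  tauto

/-- The constant in the entropy bound `log_packing_le`: the logarithm of the `4 ^ (-j)`-packing
number of a set system of dimension at most `d` is at most `entropyConst d * (j + 1)`. -/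
noncomputable def entropyConst (d : ℕ) : ℝ :=
  4 * (d + 1) + 2 * (d + 1) * Real.log (4 * (d + 1)) + 1

lemma entropyConst_nonneg (d : ℕ) : 0 ≤ entropyConst d := by
  have : 0 ≤ Real.log (4 * (d + 1)) := Real.log_nonneg (by linarith [(d.cast_nonneg : (0 : ℝ) ≤ d)])
  unfold entropyConst
  positivity

lemma log_packing_le {ι : Type*} [Fintype ι] [DecidableEq ι]
    (𝒜 : Finset (Finset ι)) (d j : ℕ) (hd : ∀ t, 𝒜.Shatters t → t.card ≤ d)
    (hsep : ∀ A ∈ 𝒜, ∀ B ∈ 𝒜, A ≠ B →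
      (Fintype.card ι : ℝ) < (4 : ℝ) ^ j * (symmDiff A B).card) :
    Real.log 𝒜.card ≤ entropyConst d * (j + 1) := by
  rcases lt_or_ge 𝒜.card 2 with h | h2
  · have : Real.log 𝒜.card = 0 := by interval_cases 𝒜.card <;> simp
    rw [this]
    have := entropyConst_nonneg d
    positivity
  set q : ℝ := (4 : ℝ) ^ j with hq
  have hq1 : 1 ≤ q := one_le_pow₀ (by norm_num)
  have hq0 : 0 < q := by linarith
  have hN : (2 : ℝ) ≤ 𝒜.card := by exact_mod_cast h2
  set L := Real.log 𝒜.card with hL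
  have hL0 : 0 ≤ L := Real.log_nonneg (by linarith)
  -- with more than `2 q L` sample points the union bound over the pairs leaves room
  set m : ℕ := ⌊2 * q * L⌋₊ + 1 with hm
  have hm1 : 2 * q * L < m := by rw [hm]; push_cast; exact Nat.lt_floor_add_one _
  have hm2 : (m : ℝ) ≤ 2 * q * L + 1 := by
    rw [hm]; push_cast
    linarith [Nat.floor_le (by positivity : 0 ≤ 2 * q * L)]
  obtain ⟨S, hSm, hS⟩ := exists_sample_injOn_trace 𝒜 h2 q hq1 hsep m (by
    have h1 : (1 - 1 / q) ^ m ≤ Real.exp (-(1 / q)) ^ m := by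
      refine pow_le_pow_left₀ ?_ ?_ m
      · rw [sub_nonneg, div_le_one hq0]; exact hq1
      · linarith [Real.add_one_le_exp (-(1 / q))]
    have h3 : (𝒜.card : ℝ) ^ 2 = Real.exp (2 * L) := by
      rw [two_mul, Real.exp_add, hL, Real.exp_log (by linarith), sq]
    rw [← Real.exp_nat_mul] at h1
    calc _ ≤ Real.exp (2 * L) * Real.exp (m * -(1 / q)) := by rw [h3]; gcongr
      _ = Real.exp (2 * L - m / q) := by rw [← Real.exp_add]; congr 1; ring
      _ < 1 := by
        rw [Real.exp_lt_one_iff, sub_neg, lt_div_iff₀ hq0]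
        linarith)
  have hcard := card_le_of_injOn_trace 𝒜 d hd S hS
  have hcard' : (𝒜.card : ℝ) ≤ (2 * q * L + 2) ^ (d + 1) := by
    have h1 : (𝒜.card : ℝ) ≤ ((m : ℝ) + 1) ^ d := by
      calc (𝒜.card : ℝ) ≤ ((S.card : ℝ) + 1) ^ d := by exact_mod_cast hcard
        _ ≤ _ := by gcongr
    calc (𝒜.card : ℝ) ≤ ((m : ℝ) + 1) ^ d := h1
      _ ≤ ((m : ℝ) + 1) ^ (d + 1) :=
          pow_le_pow_right₀ (by linarith [(m.cast_nonneg : (0 : ℝ) ≤ m)]) (by omega)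
      _ ≤ _ := pow_le_pow_left₀ (by positivity) (by linarith) _
  set D : ℝ := d + 1 with hD
  have hD1 : 1 ≤ D := by rw [hD]; linarith [(d.cast_nonneg : (0 : ℝ) ≤ d)]
  have hlog1 : L ≤ D * (Real.log q + Real.log (2 * L + 2)) := by
    have h1 := Real.log_le_log (by linarith) hcard'
    rw [Real.log_pow] at h1
    have h3 : Real.log (2 * q * L + 2) ≤ Real.log q + Real.log (2 * L + 2) := by
      rw [← Real.log_mul hq0.ne' (by positivity)]
      refine Real.log_le_log (by positivity) ?_
      nlinarith
    calc L ≤ _ := h1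
      _ = D * Real.log (2 * q * L + 2) := by rw [hD]; push_cast; ring
      _ ≤ _ := by gcongr
  -- the tangent line of the logarithm at `4 * D` absorbs the logarithm of `L`
  have hlog2 : Real.log (2 * L + 2) ≤ (2 * L + 2) / (4 * D) - 1 + Real.log (4 * D) := by
    have h1 := Real.log_le_sub_one_of_pos (x := (2 * L + 2) / (4 * D)) (by positivity)
    rw [Real.log_div (by positivity) (by positivity)] at h1
    linarith
  have hlog4 : Real.log q ≤ 2 * j := by
    rw [hq, Real.log_pow]
    have : Real.log 4 = 2 * Real.log 2 := by
      rw [show (4 : ℝ) = 2 ^ 2 by norm_num, Real.log_pow]; norm_num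
    have h1 := Real.log_two_lt_d9
    have h3 : Real.log 4 ≤ 2 := by linarith
    nlinarith [(j.cast_nonneg : (0 : ℝ) ≤ j)]
  have hl0 : 0 ≤ Real.log (4 * D) := Real.log_nonneg (by linarith)
  have hfin : L ≤ 4 * D * j + 1 + 2 * D * Real.log (4 * D) := by
    have h1 : D * (Real.log q + Real.log (2 * L + 2))
        ≤ D * (2 * j + ((2 * L + 2) / (4 * D) - 1 + Real.log (4 * D))) := by gcongr
    have h3 : D * (2 * j + ((2 * L + 2) / (4 * D) - 1 + Real.log (4 * D)))
        = 2 * D * j + L / 2 + 1 / 2 - D + D * Real.log (4 * D) := by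
      field_simp; ring
    linarith
  have hj : (0 : ℝ) ≤ j := j.cast_nonneg
  unfold entropyConst
  rw [← hD]
  have : 0 ≤ D * Real.log (4 * D) * j := by positivity
  nlinarith

/-! ### Chaining -/

section Chaining

variable {ι : Type*} [Fintype ι] [DecidableEq ι]

lemma exists_net (𝒜 : Finset (Finset ι)) (q : ℝ) :
    ∃ N ⊆ 𝒜, (∀ A ∈ N, ∀ B ∈ N, A ≠ B → (Fintype.card ι : ℝ) < q * (symmDiff A B).card) ∧
      ∀ A ∈ 𝒜, ∃ B ∈ N, q * (symmDiff A B).card ≤ Fintype.card ι := by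
  classical
  set P : Finset (Finset (Finset ι)) := 𝒜.powerset.filter fun N =>
    ∀ A ∈ N, ∀ B ∈ N, A ≠ B → (Fintype.card ι : ℝ) < q * (symmDiff A B).card with hP
  obtain ⟨N, hN, hmax⟩ := Finset.exists_max_image P Finset.card
    ⟨∅, by simp [hP]⟩
  have hN' := Finset.mem_filter.1 hN
  refine ⟨N, Finset.mem_powerset.1 hN'.1, hN'.2, fun A hA => ?_⟩
  by_contra! hcon
  have hAN : A ∉ N := fun h => by
    have := hcon A h
    simp only [symmDiff_self, Finset.bot_eq_empty, Finset.card_empty, Nat.cast_zero,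
      mul_zero] at this
    exact absurd this (not_lt.2 (Nat.cast_nonneg _))
  have hins : insert A N ∈ P := by
    refine Finset.mem_filter.2 ⟨Finset.mem_powerset.2
      (Finset.insert_subset hA (Finset.mem_powerset.1 hN'.1)), ?_⟩
    intro B hB C hC hBC
    rcases Finset.mem_insert.1 hB with hB | hB <;> rcases Finset.mem_insert.1 hC with hC | hC
    · exact absurd (hB.trans hC.symm) hBC
    · rw [hB]; exact hcon C hC
    · rw [hC, symmDiff_comm]; exact hcon B hB
    · exact hN'.2 B hB C hC hBC
  have := hmax _ hins
  rw [Finset.card_insert_of_notMem hAN] at this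
  omega

lemma sum_sq_ite_sub_ite (A B : Finset ι) :
    ∑ i, ((if i ∈ A then (1 : ℝ) else 0) - if i ∈ B then 1 else 0) ^ 2
      = ((symmDiff A B).card : ℝ) := by
  rw [Finset.card_eq_sum_ones, Nat.cast_sum, ← Finset.sum_filter_add_sum_filter_not Finset.univ
    (· ∈ symmDiff A B)]
  rw [Finset.sum_eq_zero (s := Finset.univ.filter fun i => ¬ i ∈ symmDiff A B), add_zero]
  · rw [Finset.filter_mem_eq_inter, Finset.univ_inter]
    refine Finset.sum_congr rfl fun i hi => ?_
    rcases Finset.mem_symmDiff.1 hi with h | h <;> simp [h]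
  · intro i hi
    have hi := (Finset.mem_filter.1 hi).2
    rw [Finset.mem_symmDiff] at hi
    by_cases h1 : i ∈ A <;> by_cases h3 : i ∈ B <;> simp_all

/-- The chaining step: the bound for a `4 ^ (-j)`-separated subsystem follows from the one for a
`4 ^ (-(j - 1))`-net. The weight `4 - (j + 3) / 2 ^ j` is four minus the tail of the convergent
series of the links `(i + 1) / 2 ^ i`. -/
lemma sum_abs_rademacher_separated_le (hn : 0 < Fintype.card ι) (𝒜 : Finset (Finset ι)) (d : ℕ)
    (hd : ∀ t, 𝒜.Shatters t → t.card ≤ d) (j : ℕ) :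
    ∀ N ⊆ 𝒜, (∀ A ∈ N, ∀ B ∈ N, A ≠ B →
        (Fintype.card ι : ℝ) < (4 : ℝ) ^ j * (symmDiff A B).card) →
      ∀ A : (ι → Bool) → Finset ι, (∀ e, A e ∈ N) →
        ∑ e : ι → Bool, |∑ i, sgn (e i) * if i ∈ A e then 1 else 0|
          ≤ 2 ^ Fintype.card ι * (√(Fintype.card ι) *
            ((entropyConst d + 3) * (4 - (j + 3) / 2 ^ j))) := by
  set n : ℝ := (Fintype.card ι : ℝ) with hn'
  have hn0 : 0 < n := Nat.cast_pos.2 hn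
  have hsn : 0 < √n := Real.sqrt_pos.2 hn0
  have hsq : √n ^ 2 = n := Real.sq_sqrt hn0.le
  have hc0 := entropyConst_nonneg d
  have hlog2 : Real.log 2 ≤ 1 := by linarith [Real.log_two_lt_d9]
  induction j with
  | zero =>
    intro N hN hsep A hA
    have hcard : N.card = 1 := by
      refine le_antisymm (Finset.card_le_one.2 fun B hB C hC => ?_)
        (Finset.card_pos.2 ⟨_, hA fun _ => true⟩)
      by_contra hne
      have h1 := hsep B hB C hC hne
      rw [pow_zero, one_mul, hn'] at h1
      exact absurd (Nat.cast_lt.1 h1) (not_lt.2 (Finset.card_le_univ _))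
    have hmain := sum_abs_rademacher_le N (fun B i => if i ∈ B then (1 : ℝ) else 0) n
      (fun B _ => by
        have := sum_sq_ite_sub_ite B ∅
        simp only [Finset.notMem_empty, if_false, sub_zero] at this
        rw [this, hn']
        exact_mod_cast Finset.card_le_univ _) A hA (l := 1 / √n) (by positivity)
    refine hmain.trans ?_
    rw [hcard]
    gcongr
    have h1 : (Real.log (2 * (1 : ℕ)) + (1 / √n) ^ 2 * n / 2) / (1 / √n)
        = √n * (Real.log 2 + 1 / 2) := by
      rw [div_pow, hsq]
      field_simp
      norm_num
    rw [h1]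
    gcongr
    norm_num
    linarith
  | succ j ih =>
    intro N hN hsep A hA
    obtain ⟨N', hN', hsep', hnet⟩ := exists_net 𝒜 ((4 : ℝ) ^ j)
    choose! π hπ hπd using hnet
    have h1 := ih N' hN' hsep' (fun e => π (A e)) fun e => hπ _ (hN (hA e))
    -- With `l = 2 ^ (j + 1) / √n` the quadratic term `l ^ 2 * v / 2` of each link is the constant
    -- `2`, and the links still sum to a multiple of `√n`.
    have h2 := sum_abs_rademacher_le N
      (fun B i => (if i ∈ B then (1 : ℝ) else 0) - if i ∈ π B then 1 else 0) (n / 4 ^ j)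
      (fun B hB => by
        rw [sum_sq_ite_sub_ite, le_div_iff₀ (by positivity), mul_comm]
        exact hπd B (hN hB)) A hA (l := 2 ^ (j + 1) / √n) (by positivity)
    have hlog : Real.log (2 * N.card) ≤ 1 + entropyConst d * (j + 2) := by
      have hNpos : (0 : ℝ) < N.card := by
        exact_mod_cast Finset.card_pos.2 ⟨_, hA fun _ => true⟩
      rw [Real.log_mul (by norm_num) hNpos.ne']
      have := log_packing_le N d (j + 1) (fun t ht => hd t (ht.mono_left hN)) hsep
      push_cast at this
      linarith
    have h3 : (Real.log (2 * N.card) + (2 ^ (j + 1) / √n) ^ 2 * (n / 4 ^ j) / 2)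
          / (2 ^ (j + 1) / √n)
        ≤ √n * ((entropyConst d + 3) * ((j + 2) / 2 ^ (j + 1))) := by
      have h4 : (2 ^ (j + 1) / √n) ^ 2 * (n / 4 ^ j) / 2 = 2 := by
        have h5 : ((2 : ℝ) ^ (j + 1)) ^ 2 = 4 * 4 ^ j := by
          rw [← pow_mul, mul_comm, pow_mul, pow_succ]
          norm_num
          ring
        rw [div_pow, hsq, h5]
        field_simp
        norm_num
      rw [h4, div_div_eq_mul_div, mul_comm, mul_div_assoc]
      gcongr
      rw [← mul_div_assoc]
      gcongr
      nlinarith [(j.cast_nonneg : (0 : ℝ) ≤ j)]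
    calc _ ≤ ∑ e : ι → Bool, (|∑ i, sgn (e i) * if i ∈ π (A e) then 1 else 0|
          + |∑ i, sgn (e i) * ((if i ∈ A e then (1 : ℝ) else 0)
              - if i ∈ π (A e) then 1 else 0)|) := by
          refine Finset.sum_le_sum fun e _ => ?_
          refine le_trans (le_of_eq ?_) (abs_add_le _ _)
          rw [← Finset.sum_add_distrib]
          congr 1
          exact Finset.sum_congr rfl fun i _ => by ring
      _ ≤ _ := by
          rw [Finset.sum_add_distrib]
          refine (add_le_add h1 (h2.trans (mul_le_mul_of_nonneg_left h3 (by positivity)))).trans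
            (le_of_eq ?_)
          push_cast
          rw [pow_succ]
          field_simp
          ring

/-- A constant for which Rademacher sums over a set system of dimension `d` on `n` points are
at most `chainingConst d * √n` on average. -/
noncomputable def chainingConst (d : ℕ) : ℝ := 4 * (entropyConst d + 3)

lemma chainingConst_nonneg (d : ℕ) : 0 ≤ chainingConst d := by
  have := entropyConst_nonneg d
  unfold chainingConst
  positivity

/-- The Rademacher average of a set system of bounded dimension, without a logarithmic factor. -/
theorem sum_abs_rademacher_sets_le (𝒜 : Finset (Finset ι)) (d : ℕ)
    (hd : ∀ t, 𝒜.Shatters t → t.card ≤ d)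
    (A : (ι → Bool) → Finset ι) (hA : ∀ e, A e ∈ 𝒜) :
    ∑ e : ι → Bool, |∑ i, sgn (e i) * if i ∈ A e then 1 else 0|
      ≤ 2 ^ Fintype.card ι * (chainingConst d * √(Fintype.card ι)) := by
  rcases Nat.eq_zero_or_pos (Fintype.card ι) with h0 | hn
  · have : IsEmpty ι := Fintype.card_eq_zero_iff.1 h0
    simp
  -- at a level `j` with `|ι| < 4 ^ j` all of `𝒜` is separated
  have h := sum_abs_rademacher_separated_le hn 𝒜 d hd (Fintype.card ι) 𝒜 subset_rfl
    (fun B _ C _ hBC => by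
      have h1 : 1 ≤ (symmDiff B C).card := by
        rw [Nat.one_le_iff_ne_zero, Ne, Finset.card_eq_zero]
        exact fun h => hBC (symmDiff_eq_bot.1 h)
      have h2 : Fintype.card ι < 4 ^ Fintype.card ι := Nat.lt_pow_self (by norm_num)
      have h3 : Fintype.card ι < 4 ^ Fintype.card ι * (symmDiff B C).card :=
        h2.trans_le (Nat.le_mul_of_pos_right _ h1)
      exact_mod_cast h3) A hA
  refine h.trans ?_
  have hc := entropyConst_nonneg d
  rw [chainingConst, mul_comm (√_), mul_comm 4]
  have : (0 : ℝ) ≤ ((Fintype.card ι : ℝ) + 3) / 2 ^ Fintype.card ι := by positivity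
  gcongr
  linarith

end Chaining

/-! ### Rademacher averages of function classes of finite pseudo-dimension -/

section PseudoDim

variable {𝒵 : Type*}

lemma exists_forall_shattered_le {F : Set (𝒵 → ℝ)} (hd : pseudoDim F < ⊤) :
    ∃ d : ℕ, ∀ (k : ℕ) (z : Fin k → 𝒵) (w : Fin k → ℝ),
      Set.ncard {p : Fin k → Prop | ∃ f ∈ F, p = fun i => f (z i) ≤ w i} = 2 ^ k → k ≤ d := by
  obtain ⟨d, hd'⟩ := ENat.ne_top_iff_exists.1 hd.ne
  refine ⟨d, fun k z w h => ?_⟩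
  have : (k : ℕ∞) ≤ pseudoDim F := le_sSup ⟨k, rfl, z, w, h⟩
  rw [← hd'] at this
  exact_mod_cast this

/-- The superlevel sets of `f ∈ F` at a fixed level, traced on finitely many points. -/
noncomputable def levelTraces {ι : Type*} [Fintype ι] [DecidableEq ι] (F : Set (𝒵 → ℝ))
    (z : ι → 𝒵) (w : ℝ) : Finset (Finset ι) := by
  classical
  exact Finset.univ.filter fun A => ∃ f ∈ F, A = Finset.univ.filter fun i => w < f (z i)

lemma card_le_of_shatters_levelTraces {ι : Type*} [Fintype ι] [DecidableEq ι]
    {F : Set (𝒵 → ℝ)} {d : ℕ}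
    (hd : ∀ (k : ℕ) (z : Fin k → 𝒵) (w : Fin k → ℝ),
      Set.ncard {p : Fin k → Prop | ∃ f ∈ F, p = fun i => f (z i) ≤ w i} = 2 ^ k → k ≤ d)
    (z : ι → 𝒵) (w : ℝ) (t : Finset ι) (ht : (levelTraces F z w).Shatters t) : t.card ≤ d := by
  classical
  refine hd t.card (fun i => z (t.equivFin.symm i)) (fun _ => w) ?_
  have : {p : Fin t.card → Prop | ∃ f ∈ F, p = fun i => f (z (t.equivFin.symm i)) ≤ w}
      = Set.univ := by
    refine Set.eq_univ_of_forall fun p => ?_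
    obtain ⟨u, hu, htu⟩ := ht (t := t.filter fun x => ∀ hx : x ∈ t, ¬ p (t.equivFin ⟨x, hx⟩))
      (Finset.filter_subset _ _)
    obtain ⟨f, hf, rfl⟩ := (Finset.mem_filter.1 hu).2
    refine ⟨f, hf, funext fun i => ?_⟩
    have h1 := Finset.ext_iff.1 htu (t.equivFin.symm i)
    simp only [Finset.mem_inter, Finset.coe_mem, Finset.mem_filter, Finset.mem_univ, true_and,
      Subtype.coe_eta, Equiv.apply_symm_apply, forall_const] at h1
    rw [eq_iff_iff, ← not_lt, h1, not_not]
  rw [this, Set.ncard_univ, Nat.card_eq_fintype_card]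
  simp

/-- Rademacher averages of a class of `[0, 1]`-valued functions of finite pseudo-dimension. The
layer cake formula `f = ∫₀¹ 𝟙[w < f] dw` reduces the bound to the superlevel sets at each fixed
level `w`, which form a system of bounded Vapnik–Chervonenkis dimension. -/
theorem sum_abs_rademacher_class_le {ι : Type*} [Fintype ι] [DecidableEq ι]
    {F : Set (𝒵 → ℝ)} (hF : ∀ f ∈ F, ∀ z, f z ∈ Set.Icc (0 : ℝ) 1) {d : ℕ}
    (hd : ∀ (k : ℕ) (z : Fin k → 𝒵) (w : Fin k → ℝ),
      Set.ncard {p : Fin k → Prop | ∃ f ∈ F, p = fun i => f (z i) ≤ w i} = 2 ^ k → k ≤ d)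
    (z : ι → 𝒵) (f : (ι → Bool) → 𝒵 → ℝ) (hf : ∀ e, f e ∈ F) :
    ∑ e : ι → Bool, |∑ i, sgn (e i) * f e (z i)|
      ≤ 2 ^ Fintype.card ι * (chainingConst d * √(Fintype.card ι)) := by
  classical
  have hint : ∀ x : ℝ, IntervalIntegrable (fun w : ℝ => if w < x then (1 : ℝ) else 0)
      volume 0 1 := fun x => by
    refine (AntitoneOn.intervalIntegrable fun a _ b _ hab => ?_)
    by_cases h : b < x
    · simp [h, hab.trans_lt h]
    · simp only [h, if_false]; split_ifs <;> norm_num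
  have hlayer : ∀ x ∈ Set.Icc (0 : ℝ) 1, ∫ w in (0 : ℝ)..1, (if w < x then (1 : ℝ) else 0) = x := by
    intro x hx
    rw [← intervalIntegral.integral_add_adjacent_intervals (b := x)
      ((hint x).mono_set (by
        rw [Set.uIcc_of_le hx.1, Set.uIcc_of_le zero_le_one]
        exact Set.Icc_subset_Icc_right hx.2))
      ((hint x).mono_set (by
        rw [Set.uIcc_of_le hx.2, Set.uIcc_of_le zero_le_one]
        exact Set.Icc_subset_Icc_left hx.1))]
    have h1 : ∫ w in (0 : ℝ)..x, (if w < x then (1 : ℝ) else 0) = ∫ w in (0 : ℝ)..x, (1 : ℝ) := by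
      refine intervalIntegral.integral_congr_ae ?_
      have hne : ∀ᵐ w : ℝ, w ≠ x := by simp [ae_iff, measure_singleton]
      filter_upwards [hne] with w hw hw'
      rw [Set.uIoc_of_le hx.1] at hw'
      simp [lt_of_le_of_ne hw'.2 hw]
    have h2 : ∫ w in x..(1 : ℝ), (if w < x then (1 : ℝ) else 0) = ∫ w in x..(1 : ℝ), (0 : ℝ) := by
      refine intervalIntegral.integral_congr_ae (Eventually.of_forall fun w hw => ?_)
      rw [Set.uIoc_of_le hx.2] at hw
      simp [hw.1.le]
    rw [h1, h2]; simp
  have hI : ∀ e : ι → Bool, IntervalIntegrable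
      (fun w : ℝ => ∑ i, sgn (e i) * if w < f e (z i) then (1 : ℝ) else 0) volume 0 1 := fun e => by
    have := IntervalIntegrable.sum Finset.univ
      (f := fun i (w : ℝ) => sgn (e i) * if w < f e (z i) then (1 : ℝ) else 0)
      (fun i _ => (hint (f e (z i))).const_mul (sgn (e i)))
    rwa [Finset.sum_fn] at this
  have hIabs : ∀ e : ι → Bool, IntervalIntegrable
      (fun w : ℝ => |∑ i, sgn (e i) * if w < f e (z i) then (1 : ℝ) else 0|) volume 0 1 :=
    fun e => (hI e).abs
  calc _ = ∑ e : ι → Bool, |∫ w in (0 : ℝ)..1,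
        ∑ i, sgn (e i) * if w < f e (z i) then (1 : ℝ) else 0| := by
        refine Finset.sum_congr rfl fun e _ => ?_
        rw [intervalIntegral.integral_finsetSum
          fun i _ => (hint (f e (z i))).const_mul (sgn (e i))]
        congr 1
        refine Finset.sum_congr rfl fun i _ => ?_
        rw [intervalIntegral.integral_const_mul, hlayer _ (hF _ (hf e) _)]
    _ ≤ ∑ e : ι → Bool, ∫ w in (0 : ℝ)..1,
        |∑ i, sgn (e i) * if w < f e (z i) then (1 : ℝ) else 0| :=
        Finset.sum_le_sum fun e _ => intervalIntegral.abs_integral_le_integral_abs zero_le_one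
    _ = ∫ w in (0 : ℝ)..1, ∑ e : ι → Bool,
        |∑ i, sgn (e i) * if w < f e (z i) then (1 : ℝ) else 0| := by
        rw [intervalIntegral.integral_finsetSum fun e _ => hIabs e]
    _ ≤ ∫ w in (0 : ℝ)..1, 2 ^ Fintype.card ι * (chainingConst d * √(Fintype.card ι)) := by
        refine intervalIntegral.integral_mono_on zero_le_one ?_ (by simp) fun w _ => ?_
        · have := IntervalIntegrable.sum Finset.univ fun e _ => hIabs e
          rwa [Finset.sum_fn] at this
        · have := sum_abs_rademacher_sets_le (levelTraces F z w) d
            (card_le_of_shatters_levelTraces hd z w)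
            (fun e => Finset.univ.filter fun i => w < f e (z i))
            (fun e => Finset.mem_filter.2 ⟨Finset.mem_univ _, f e, hf e, rfl⟩)
          simpa only [Finset.mem_filter, Finset.mem_univ, true_and] using this
    _ = _ := by simp

end PseudoDim

/-! ### Decoupling by β-mixing -/

section Decoupling

/-- The sets in a product space that are unions of cells of a finite measurable product grid. -/
def gridSets (𝒰 𝒱 : Type*) [MeasurableSpace 𝒰] [MeasurableSpace 𝒱] : Set (Set (𝒰 × 𝒱)) :=
  {C | ∃ (I J : ℕ) (u : 𝒰 → Fin I) (v : 𝒱 → Fin J) (S : Set (Fin I × Fin J)),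
    Measurable u ∧ Measurable v ∧ C = (fun p : 𝒰 × 𝒱 => (u p.1, v p.2)) ⁻¹' S}

variable {Ω 𝒰 𝒱 : Type*}

lemma isSetAlgebra_gridSets [MeasurableSpace 𝒰] [MeasurableSpace 𝒱] :
    IsSetAlgebra (gridSets 𝒰 𝒱) where
  empty_mem := ⟨1, 1, fun _ => 0, fun _ => 0, ∅, measurable_const, measurable_const, by simp⟩
  compl_mem := by
    rintro _ ⟨I, J, u, v, S, hu, hv, rfl⟩
    exact ⟨I, J, u, v, Sᶜ, hu, hv, rfl⟩
  union_mem := by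
    rintro _ _ ⟨I, J, u, v, S, hu, hv, rfl⟩ ⟨I', J', u', v', S', hu', hv', rfl⟩
    refine ⟨I * I', J * J', fun x => finProdFinEquiv (u x, u' x),
      fun y => finProdFinEquiv (v y, v' y),
      {p | ((finProdFinEquiv.symm p.1).1, (finProdFinEquiv.symm p.2).1) ∈ S ∨
        ((finProdFinEquiv.symm p.1).2, (finProdFinEquiv.symm p.2).2) ∈ S'},
      (Measurable.of_discrete (f := finProdFinEquiv)).comp (hu.prodMk hu'),
      (Measurable.of_discrete (f := finProdFinEquiv)).comp (hv.prodMk hv'), ?_⟩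
    ext p
    simp only [Set.mem_union, Set.mem_preimage, Set.mem_ofPred_eq, Equiv.symm_apply_apply]

lemma generateFrom_gridSets [MeasurableSpace 𝒰] [MeasurableSpace 𝒱] :
    (Prod.instMeasurableSpace : MeasurableSpace (𝒰 × 𝒱))
      = MeasurableSpace.generateFrom (gridSets 𝒰 𝒱) := by
  classical
  refine le_antisymm ?_ (MeasurableSpace.generateFrom_le ?_)
  · rw [← generateFrom_prod]
    refine MeasurableSpace.generateFrom_mono ?_
    rintro _ ⟨s, hs, t, ht, rfl⟩
    refine ⟨2, 2, fun x => if x ∈ s then 1 else 0, fun y => if y ∈ t then 1 else 0, {(1, 1)},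
      Measurable.ite hs measurable_const measurable_const,
      Measurable.ite ht measurable_const measurable_const, ?_⟩
    ext p
    simp
  · rintro _ ⟨I, J, u, v, S, hu, hv, rfl⟩
    exact ((hu.comp measurable_fst).prodMk (hv.comp measurable_snd)) (Set.toFinite S).measurableSet

/-- Half of the total absolute mass of a balanced finite family bounds each partial sum. -/
lemma two_mul_sum_le_sum_abs {κ : Type*} [Fintype κ] [DecidableEq κ] (D : κ → ℝ)
    (hD : ∑ p, D p = 0) (S : Finset κ) : 2 * ∑ p ∈ S, D p ≤ ∑ p, |D p| := by
  have h1 : ∑ p ∈ S, D p + ∑ p ∈ Sᶜ, D p = 0 := by rw [Finset.sum_add_sum_compl, hD]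
  have h2 : ∑ p ∈ S, |D p| + ∑ p ∈ Sᶜ, |D p| = ∑ p, |D p| := Finset.sum_add_sum_compl _ _
  have h3 : ∑ p ∈ S, D p ≤ ∑ p ∈ S, |D p| := Finset.sum_le_sum fun _ _ => le_abs_self _
  have h4 : -∑ p ∈ Sᶜ, D p ≤ ∑ p ∈ Sᶜ, |D p| := by
    rw [← Finset.sum_neg_distrib]
    exact Finset.sum_le_sum fun _ _ => neg_le_abs _
  linarith

/-- A bound `b` on the dependence between two σ-algebras, tested on finite partitions, bounds the
distance between the joint law of two random variables measurable with respect to them and the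
product of their laws, on all measurable sets. -/
theorem joint_le_prod_add {m1 m2 mΩ : MeasurableSpace Ω} (h1 : m1 ≤ mΩ) (h2 : m2 ≤ mΩ)
    (μ : Measure Ω) [IsProbabilityMeasure μ] (b : ℝ)
    (hb : ∀ (I J : ℕ) (A : Fin I → Set Ω) (B : Fin J → Set Ω), IsFinPartition m1 A →
      IsFinPartition m2 B →
        ∑ i, ∑ j, |μ.real (A i ∩ B j) - μ.real (A i) * μ.real (B j)| ≤ 2 * b)
    {m𝒰 : MeasurableSpace 𝒰} {m𝒱 : MeasurableSpace 𝒱} {U : Ω → 𝒰} {V : Ω → 𝒱}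
    (hU : Measurable[m1] U) (hV : Measurable[m2] V) {C : Set (𝒰 × 𝒱)} (hC : MeasurableSet C) :
    (μ.map fun ω => (U ω, V ω)) C ≤ ((μ.map U).prod (μ.map V)) C + ENNReal.ofReal b := by
  classical
  have hU' : Measurable U := hU.mono h1 le_rfl
  have hV' : Measurable V := hV.mono h2 le_rfl
  have hUV : Measurable fun ω => (U ω, V ω) := hU'.prodMk hV'
  have : IsProbabilityMeasure (μ.map U) := Measure.isProbabilityMeasure_map hU'.aemeasurable
  have : IsProbabilityMeasure (μ.map V) := Measure.isProbabilityMeasure_map hV'.aemeasurable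
  set ν := μ.map fun ω => (U ω, V ω) with hν
  have : IsProbabilityMeasure ν := Measure.isProbabilityMeasure_map hUV.aemeasurable
  set ν' := (μ.map U).prod (μ.map V) with hν'
  have hgrid : ∀ T ∈ gridSets 𝒰 𝒱, ν.real T ≤ ν'.real T + b := by
    rintro _ ⟨I, J, u, v, S, hu, hv, rfl⟩
    set g : 𝒰 × 𝒱 → Fin I × Fin J := fun p => (u p.1, v p.2) with hg
    have hgm : Measurable g := (hu.comp measurable_fst).prodMk (hv.comp measurable_snd)
    have hgs : ∀ p, MeasurableSet (g ⁻¹' {p}) := fun p => hgm (measurableSet_singleton p)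
    have hsum : ∀ (ρ : Measure (𝒰 × 𝒱)) [IsProbabilityMeasure ρ] (S : Finset (Fin I × Fin J)),
        ∑ p ∈ S, ρ.real (g ⁻¹' {p}) = ρ.real (g ⁻¹' S) := fun ρ _ S =>
      sum_measureReal_preimage_singleton S fun p _ => hgs p
    have hcell : ∀ p : Fin I × Fin J, ν.real (g ⁻¹' {p}) - ν'.real (g ⁻¹' {p})
        = μ.real (U ⁻¹' (u ⁻¹' {p.1}) ∩ V ⁻¹' (v ⁻¹' {p.2}))
          - μ.real (U ⁻¹' (u ⁻¹' {p.1})) * μ.real (V ⁻¹' (v ⁻¹' {p.2})) := by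
      rintro ⟨i, j⟩
      have hrect : g ⁻¹' {(i, j)} = (u ⁻¹' {i}) ×ˢ (v ⁻¹' {j}) := by
        ext p; simp [hg]
      have hui : MeasurableSet (u ⁻¹' {i}) := hu (measurableSet_singleton i)
      have hvj : MeasurableSet (v ⁻¹' {j}) := hv (measurableSet_singleton j)
      congr 1
      · rw [hν, map_measureReal_apply hUV (hgs _), hrect]
        rfl
      · rw [hrect, hν', measureReal_prod_prod, map_measureReal_apply hU' hui,
          map_measureReal_apply hV' hvj]
    have htot : ∑ p, (ν.real (g ⁻¹' {p}) - ν'.real (g ⁻¹' {p})) = 0 := by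
      rw [Finset.sum_sub_distrib, hsum ν, hsum ν']
      simp
    have hpart := two_mul_sum_le_sum_abs _ htot S.toFinset
    rw [Finset.sum_sub_distrib, hsum ν, hsum ν', Set.coe_toFinset] at hpart
    have hb' := hb I J (fun i => U ⁻¹' (u ⁻¹' {i})) (fun j => V ⁻¹' (v ⁻¹' {j}))
      ⟨fun i => hU (hu (measurableSet_singleton i)),
        fun i i' hne => Set.disjoint_left.2 fun ω hi hi' => hne (hi.symm.trans hi'),
        Set.eq_univ_of_forall fun ω => Set.mem_iUnion.2 ⟨u (U ω), rfl⟩⟩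
      ⟨fun j => hV (hv (measurableSet_singleton j)),
        fun j j' hne => Set.disjoint_left.2 fun ω hj hj' => hne (hj.symm.trans hj'),
        Set.eq_univ_of_forall fun ω => Set.mem_iUnion.2 ⟨v (V ω), rfl⟩⟩
    rw [← Fintype.sum_prod_type'
      (f := fun i j => |μ.real (U ⁻¹' (u ⁻¹' {i}) ∩ V ⁻¹' (v ⁻¹' {j}))
        - μ.real (U ⁻¹' (u ⁻¹' {i})) * μ.real (V ⁻¹' (v ⁻¹' {j}))|)] at hb'
    have heq : ∑ p : Fin I × Fin J, |ν.real (g ⁻¹' {p}) - ν'.real (g ⁻¹' {p})|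
        = ∑ p : Fin I × Fin J, |μ.real (U ⁻¹' (u ⁻¹' {p.1}) ∩ V ⁻¹' (v ⁻¹' {p.2}))
          - μ.real (U ⁻¹' (u ⁻¹' {p.1})) * μ.real (V ⁻¹' (v ⁻¹' {p.2}))| :=
      Finset.sum_congr rfl fun p _ => by rw [hcell]
    rw [heq] at hpart
    linarith
  have hreal : ν.real C ≤ ν'.real C + b := by
    refine le_of_forall_pos_le_add fun ε hε => ?_
    have hdense := Measure.MeasureDense.of_generateFrom_isSetAlgebra_finite (ν + ν')
      isSetAlgebra_gridSets generateFrom_gridSets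
    obtain ⟨T, hT, hCT⟩ := hdense.approx C hC (measure_ne_top _ _) ε hε
    have hTm := hdense.measurable T hT
    have h3 : (ν + ν').real (symmDiff C T) < ε := by
      rw [measureReal_def]
      exact (ENNReal.toReal_lt_of_lt_ofReal hCT)
    rw [measureReal_add_apply] at h3
    have h4 := abs_le.1 (abs_measureReal_sub_le_measureReal_symmDiff (μ := ν)
      hC.nullMeasurableSet hTm.nullMeasurableSet)
    have h5 := abs_le.1 (abs_measureReal_sub_le_measureReal_symmDiff (μ := ν')
      hC.nullMeasurableSet hTm.nullMeasurableSet)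
    linarith [hgrid T hT]
  rw [← ofReal_measureReal, ← ofReal_measureReal (μ := ν')]
  refine (ENNReal.ofReal_le_ofReal hreal).trans ENNReal.ofReal_add_le

/-- Setwise closeness of two laws carries over to integrals of `[0, 1]`-valued functions. -/
lemma integral_le_add_of_measure_le {m𝒰 : MeasurableSpace 𝒰} {ν ν' : Measure 𝒰}
    [IsProbabilityMeasure ν] [IsProbabilityMeasure ν'] {b : ℝ} (hb : 0 ≤ b)
    (h : ∀ C, MeasurableSet C → ν C ≤ ν' C + ENNReal.ofReal b)
    {g : 𝒰 → ℝ} (hg : Measurable g) (hg01 : ∀ x, g x ∈ Set.Icc (0 : ℝ) 1) :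
    ∫ x, g x ∂ν ≤ ∫ x, g x ∂ν' + b := by
  have hint : ∀ (ρ : Measure 𝒰) [IsProbabilityMeasure ρ], Integrable g ρ := fun ρ _ =>
    Integrable.of_mem_Icc 0 1 hg.aemeasurable (Eventually.of_forall hg01)
  have hlayer : ∀ (ρ : Measure 𝒰) [IsProbabilityMeasure ρ],
      ∫ x, g x ∂ρ = ∫ t in Set.Ioc (0 : ℝ) 1, ρ.real {x | t ≤ g x} := fun ρ _ =>
    (hint ρ).integral_eq_integral_Ioc_meas_le (Eventually.of_forall fun x => (hg01 x).1)
      (Eventually.of_forall fun x => (hg01 x).2)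
  have hanti : ∀ (ρ : Measure 𝒰) [IsProbabilityMeasure ρ],
      IntegrableOn (fun t : ℝ => ρ.real {x | t ≤ g x}) (Set.Ioc 0 1) := fun ρ _ => by
    have : AntitoneOn (fun t : ℝ => ρ.real {x | t ≤ g x}) (Set.Icc 0 1) :=
      fun s _ t _ hst => measureReal_mono fun x hx => hst.trans hx
    exact (this.integrableOn_isCompact isCompact_Icc).mono_set Set.Ioc_subset_Icc_self
  rw [hlayer ν, hlayer ν']
  have hmono : ∫ t in Set.Ioc (0 : ℝ) 1, ν.real {x | t ≤ g x}
      ≤ ∫ t in Set.Ioc (0 : ℝ) 1, (ν'.real {x | t ≤ g x} + b) := by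
    refine setIntegral_mono (hanti ν) ((hanti ν').add (by simp)) fun t => ?_
    have hm : MeasurableSet {x | t ≤ g x} := measurableSet_le measurable_const hg
    have h1 := ENNReal.toReal_mono (by finiteness) (h _ hm)
    rwa [ENNReal.toReal_add (measure_ne_top _ _) (by finiteness), ENNReal.toReal_ofReal hb] at h1
  refine hmono.trans (le_of_eq ?_)
  rw [integral_add (hanti ν') (by simp)]
  simp

end Decoupling

lemma IsFinPartition.sum_measureReal_inter {Ω : Type*} {m mΩ : MeasurableSpace Ω} (hm : m ≤ mΩ)
    (μ : Measure Ω) [IsProbabilityMeasure μ] {I : ℕ} {A : Fin I → Set Ω} (hA : IsFinPartition m A)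
    (B : Set Ω) (hB : MeasurableSet B) : ∑ i, μ.real (A i ∩ B) = μ.real B := by
  rw [← measureReal_iUnion_fintype
    (fun i j hij => (hA.disjoint hij).mono Set.inter_subset_left Set.inter_subset_left)
    (fun i => (hm _ (hA.measurable i)).inter hB), ← Set.iUnion_inter, hA.cover, Set.univ_inter]

lemma measurable_sigmaGen {Ω 𝒵 : Type*} [MeasurableSpace 𝒵] {Z : ℕ → Ω → 𝒵} {S : Set ℕ} {t : ℕ}
    (ht : t ∈ S) : Measurable[sigmaGen Z S] (Z t) :=
  (comap_measurable (Z t)).mono (le_iSup₂_of_le t ht le_rfl) le_rfl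

lemma betaMix_nonneg {Ω 𝒵 : Type*} [MeasurableSpace Ω] [MeasurableSpace 𝒵] (μ : Measure Ω)
    {Z : ℕ → Ω → 𝒵} (k : ℕ) : 0 ≤ betaMix μ Z k := by
  unfold betaMix
  refine mul_nonneg (by norm_num) (Real.sSup_nonneg ?_)
  rintro _ ⟨ℓ, -, I, J, A, B, -, -, rfl⟩
  positivity

section BetaMixing

variable {Ω 𝒵 : Type*} [MeasurableSpace Ω] [MeasurableSpace 𝒵]

lemma sigmaGen_le {Z : ℕ → Ω → 𝒵} {S : Set ℕ} (hZ : ∀ t ∈ S, Measurable (Z t)) :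
    sigmaGen Z S ≤ ‹MeasurableSpace Ω› :=
  iSup₂_le fun t ht => (hZ t ht).comap_le

variable (μ : Measure Ω) [IsProbabilityMeasure μ] {Z : ℕ → Ω → 𝒵}

/-- The supremum in the definition of `betaMix` is over a bounded set, hence an upper bound. -/
lemma sum_abs_le_two_mul_betaMix (hZ : ∀ t, 1 ≤ t → Measurable (Z t)) {k ℓ : ℕ} (hℓ : 1 ≤ ℓ)
    (I J : ℕ) (A : Fin I → Set Ω) (B : Fin J → Set Ω)
    (hA : IsFinPartition (sigmaGen Z (Set.Icc 1 ℓ)) A)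
    (hB : IsFinPartition (sigmaGen Z (Set.Ici (ℓ + k))) B) :
    ∑ i, ∑ j, |μ.real (A i ∩ B j) - μ.real (A i) * μ.real (B j)| ≤ 2 * betaMix μ Z k := by
  have hbdd : ∑ i, ∑ j, |μ.real (A i ∩ B j) - μ.real (A i) * μ.real (B j)| ≤
      sSup {x : ℝ | ∃ ℓ : ℕ, 1 ≤ ℓ ∧
        ∃ (I J : ℕ) (A : Fin I → Set Ω) (B : Fin J → Set Ω),
          IsFinPartition (sigmaGen Z (Set.Icc 1 ℓ)) A ∧
          IsFinPartition (sigmaGen Z (Set.Ici (ℓ + k))) B ∧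
          x = ∑ i, ∑ j, |μ.real (A i ∩ B j) - μ.real (A i) * μ.real (B j)|} := by
    refine le_csSup ⟨2, ?_⟩ ⟨ℓ, hℓ, I, J, A, B, hA, hB, rfl⟩
    rintro _ ⟨ℓ, hℓ, I, J, A, B, hA, hB, rfl⟩
    have hm1 : sigmaGen Z (Set.Icc 1 ℓ) ≤ ‹MeasurableSpace Ω› := sigmaGen_le fun t ht => hZ t ht.1
    have hm2 : sigmaGen Z (Set.Ici (ℓ + k)) ≤ ‹MeasurableSpace Ω› :=
      sigmaGen_le fun t ht => hZ t (by have := Set.mem_Ici.1 ht; omega)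
    have hsA : ∑ i, μ.real (A i) = 1 := by
      have := hA.sum_measureReal_inter hm1 μ Set.univ MeasurableSet.univ
      simpa using this
    have hsB : ∑ j, μ.real (B j) = 1 := by
      have := hB.sum_measureReal_inter hm2 μ Set.univ MeasurableSet.univ
      simpa using this
    calc _ ≤ ∑ i, ∑ j, (μ.real (A i ∩ B j) + μ.real (A i) * μ.real (B j)) := by
          refine Finset.sum_le_sum fun i _ => Finset.sum_le_sum fun j _ => ?_
          refine (abs_sub _ _).trans_eq ?_
          rw [abs_of_nonneg measureReal_nonneg, abs_of_nonneg (by positivity)]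
      _ = ∑ i, (μ.real (A i) + μ.real (A i)) := by
          refine Finset.sum_congr rfl fun i _ => ?_
          rw [Finset.sum_add_distrib, ← Finset.mul_sum, hsB, mul_one]
          congr 1
          rw [← hB.sum_measureReal_inter hm2 μ _ (hm1 _ (hA.measurable i))]
          exact Finset.sum_congr rfl fun j _ => by rw [Set.inter_comm]
      _ = 2 := by rw [Finset.sum_add_distrib, hsA]; norm_num
  unfold betaMix
  linarith

/-- Decoupling of the past up to time `ℓ` from the future from time `ℓ + k` on. -/
lemma joint_le_prod_add_betaMix (hZ : ∀ t, 1 ≤ t → Measurable (Z t)) {k ℓ : ℕ} (hℓ : 1 ≤ ℓ)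
    {𝒰 𝒱 : Type*} {m𝒰 : MeasurableSpace 𝒰} {m𝒱 : MeasurableSpace 𝒱} {U : Ω → 𝒰} {V : Ω → 𝒱}
    (hU : Measurable[sigmaGen Z (Set.Icc 1 ℓ)] U)
    (hV : Measurable[sigmaGen Z (Set.Ici (ℓ + k))] V) {C : Set (𝒰 × 𝒱)} (hC : MeasurableSet C) :
    (μ.map fun ω => (U ω, V ω)) C
      ≤ ((μ.map U).prod (μ.map V)) C + ENNReal.ofReal (betaMix μ Z k) :=
  joint_le_prod_add (sigmaGen_le fun t ht => hZ t ht.1)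
    (sigmaGen_le fun t ht => hZ t (by have := Set.mem_Ici.1 ht; omega)) μ _
    (sum_abs_le_two_mul_betaMix μ hZ hℓ) hU hV hC

/-- The joint law of observations at times at least `k` apart is close to the product of the
marginal laws: the earliest observation is split off, and the others are decoupled in turn. -/
theorem law_le_pi_add_betaMix (hZ : ∀ t, 1 ≤ t → Measurable (Z t)) (k n : ℕ) :
    ∀ (τ : Fin n → ℕ), (∀ i, 1 ≤ τ i) → (∀ i j, i < j → τ i + k ≤ τ j) →
      ∀ C : Set (Fin n → 𝒵), MeasurableSet C →
        (μ.map fun ω i => Z (τ i) ω) C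
          ≤ (Measure.pi fun i => μ.map (Z (τ i))) C + ENNReal.ofReal (n * betaMix μ Z k) := by
  induction n with
  | zero =>
    intro τ h1 _ C hC
    have hm : Measurable fun ω (i : Fin 0) => Z (τ i) ω := measurable_pi_lambda _ fun i => i.elim0
    have : IsProbabilityMeasure (μ.map fun ω (i : Fin 0) => Z (τ i) ω) :=
      Measure.isProbabilityMeasure_map hm.aemeasurable
    rcases C.eq_empty_or_nonempty with rfl | hne
    · simp
    · rw [Set.Nonempty.eq_univ hne]
      simp
  | succ n ih =>
    intro τ h1 hgap C hC
    have hP : ∀ i, IsProbabilityMeasure (μ.map (Z (τ i))) := fun i =>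
      Measure.isProbabilityMeasure_map (hZ _ (h1 i)).aemeasurable
    set e := MeasurableEquiv.piFinSuccAbove (fun _ : Fin (n + 1) => 𝒵) 0 with he
    have hmp := measurePreserving_piFinSuccAbove (fun i => μ.map (Z (τ i))) 0
    set D : Set (𝒵 × (Fin n → 𝒵)) := e.symm ⁻¹' C with hD
    have hDm : MeasurableSet D := e.symm.measurable hC
    have hCD : C = e ⁻¹' D := by
      rw [hD, ← Set.preimage_comp]
      simp
    have hmall : Measurable fun ω i => Z (τ i) ω :=
      measurable_pi_lambda _ fun i => hZ _ (h1 i)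
    have hmtail : Measurable fun ω (i : Fin n) => Z (τ i.succ) ω :=
      measurable_pi_lambda _ fun i => hZ _ (h1 _)
    have hlaw : (μ.map fun ω i => Z (τ i) ω) C
        = (μ.map fun ω => (Z (τ 0) ω, fun i : Fin n => Z (τ i.succ) ω)) D := by
      rw [Measure.map_apply hmall hC, Measure.map_apply ((hZ _ (h1 0)).prodMk hmtail) hDm, hCD]
      rfl
    have hpi : (Measure.pi fun i => μ.map (Z (τ i))) C
        = ((μ.map (Z (τ 0))).prod (Measure.pi fun i : Fin n => μ.map (Z (τ i.succ)))) D := by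
      have := hmp.measure_preimage hDm.nullMeasurableSet
      rw [hCD]
      exact this
    have hdec := joint_le_prod_add_betaMix μ hZ (k := k) (h1 0)
      (U := Z (τ 0)) (V := fun ω (i : Fin n) => Z (τ i.succ) ω)
      (measurable_sigmaGen ⟨h1 0, le_rfl⟩)
      (@measurable_pi_lambda _ _ _ (sigmaGen Z (Set.Ici (τ 0 + k))) _ _ fun i =>
        measurable_sigmaGen (hgap 0 i.succ (Fin.succ_pos i))) hDm
    have hprob : IsProbabilityMeasure (μ.map fun ω (i : Fin n) => Z (τ i.succ) ω) :=
      Measure.isProbabilityMeasure_map hmtail.aemeasurable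
    have htail : ((μ.map (Z (τ 0))).prod (μ.map fun ω (i : Fin n) => Z (τ i.succ) ω)) D
        ≤ ((μ.map (Z (τ 0))).prod (Measure.pi fun i : Fin n => μ.map (Z (τ i.succ)))) D
          + ENNReal.ofReal (n * betaMix μ Z k) := by
      rw [Measure.prod_apply hDm, Measure.prod_apply hDm]
      calc _ ≤ ∫⁻ x, ((Measure.pi fun i : Fin n => μ.map (Z (τ i.succ))) (Prod.mk x ⁻¹' D)
            + ENNReal.ofReal (n * betaMix μ Z k)) ∂(μ.map (Z (τ 0))) :=
            lintegral_mono fun x => ih (fun i => τ i.succ) (fun i => h1 _)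
              (fun i j hij => hgap _ _ (Fin.succ_lt_succ_iff.2 hij)) _
              (measurable_prodMk_left hDm)
        _ = _ := by
            rw [lintegral_add_right _ measurable_const]
            simp
    rw [hlaw, hpi]
    refine hdec.trans ((add_le_add_left htail _).trans (le_of_eq ?_))
    rw [add_assoc, ← ENNReal.ofReal_add (mul_nonneg n.cast_nonneg (betaMix_nonneg μ k))
      (betaMix_nonneg μ k)]
    congr 2
    push_cast
    ring

end BetaMixing

/-! ### Symmetrization -/

section Symmetrization

variable {𝒵 : Type*}

/-- The largest difference over `f ∈ F` between the empirical sums of two samples. -/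
noncomputable def ghostSup (F : Set (𝒵 → ℝ)) {n : ℕ} (p : (Fin n → 𝒵) × (Fin n → 𝒵)) : ℝ :=
  ⨆ f : F, |∑ i, (f.1 (p.1 i) - f.1 (p.2 i))|

lemma abs_sum_sub_le {n : ℕ} {f : 𝒵 → ℝ} (hf : ∀ z, f z ∈ Set.Icc (0 : ℝ) 1) (e : Fin n → Bool)
    (x y : Fin n → 𝒵) : |∑ i, sgn (e i) * (f (x i) - f (y i))| ≤ n := by
  refine (Finset.abs_sum_le_sum_abs _ _).trans ?_
  refine (Finset.sum_le_card_nsmul _ _ 1 fun i _ => ?_).trans (by simp)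
  rw [abs_mul, abs_sgn, one_mul, abs_le]
  have h1 := hf (x i)
  have h2 := hf (y i)
  exact ⟨by linarith [h1.1, h2.2], by linarith [h1.2, h2.1]⟩

/-- Exchanging the two samples at the coordinates with a negative sign. -/
def swapAt {n : ℕ} (e : Fin n → Bool) (p : (Fin n → 𝒵) × (Fin n → 𝒵)) :
    (Fin n → 𝒵) × (Fin n → 𝒵) :=
  (fun i => if e i then p.1 i else p.2 i, fun i => if e i then p.2 i else p.1 i)

lemma ghostSup_swapAt (F : Set (𝒵 → ℝ)) {n : ℕ} (e : Fin n → Bool)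
    (p : (Fin n → 𝒵) × (Fin n → 𝒵)) :
    ghostSup F (swapAt e p) = ⨆ f : F, |∑ i, sgn (e i) * (f.1 (p.1 i) - f.1 (p.2 i))| := by
  unfold ghostSup swapAt
  congr 1
  ext f
  congr 1
  refine Finset.sum_congr rfl fun i _ => ?_
  dsimp only
  cases e i <;> simp [sgn]

lemma bddAbove_ghost {F : Set (𝒵 → ℝ)} (hF : ∀ f ∈ F, ∀ z, f z ∈ Set.Icc (0 : ℝ) 1) {n : ℕ}
    (e : Fin n → Bool) (p : (Fin n → 𝒵) × (Fin n → 𝒵)) :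
    BddAbove (Set.range fun f : F => |∑ i, sgn (e i) * (f.1 (p.1 i) - f.1 (p.2 i))|) :=
  ⟨n, by rintro _ ⟨f, rfl⟩; exact abs_sum_sub_le (hF _ f.2) e _ _⟩

lemma ghostSup_mem_Icc {F : Set (𝒵 → ℝ)} (hF : ∀ f ∈ F, ∀ z, f z ∈ Set.Icc (0 : ℝ) 1) {n : ℕ}
    (p : (Fin n → 𝒵) × (Fin n → 𝒵)) : ghostSup F p ∈ Set.Icc (0 : ℝ) n := by
  refine ⟨Real.iSup_nonneg fun f => abs_nonneg _, Real.iSup_le (fun f => ?_) n.cast_nonneg⟩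
  simpa [sgn] using abs_sum_sub_le (hF _ f.2) (fun _ => true) p.1 p.2

lemma le_ghostSup {F : Set (𝒵 → ℝ)} (hF : ∀ f ∈ F, ∀ z, f z ∈ Set.Icc (0 : ℝ) 1) {n : ℕ}
    (p : (Fin n → 𝒵) × (Fin n → 𝒵)) {f : 𝒵 → ℝ} (hf : f ∈ F) :
    ∑ i, (f (p.1 i) - f (p.2 i)) ≤ ghostSup F p := by
  have h := bddAbove_ghost hF (fun _ => true) p
  simp only [sgn, if_true, one_mul] at h
  exact (le_abs_self _).trans (le_ciSup h (⟨f, hf⟩ : F))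

/-- On average over the signs, the symmetrized suprema are controlled by the Rademacher averages
of the class on each of the two samples. -/
lemma sum_ghostSup_swapAt_le {F : Set (𝒵 → ℝ)} (hne : F.Nonempty)
    (hF : ∀ f ∈ F, ∀ z, f z ∈ Set.Icc (0 : ℝ) 1) {d : ℕ}
    (hd : ∀ (k : ℕ) (z : Fin k → 𝒵) (w : Fin k → ℝ),
      Set.ncard {p : Fin k → Prop | ∃ f ∈ F, p = fun i => f (z i) ≤ w i} = 2 ^ k → k ≤ d)
    {n : ℕ} (p : (Fin n → 𝒵) × (Fin n → 𝒵)) :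
    ∑ e : Fin n → Bool, ghostSup F (swapAt e p) ≤ 2 ^ n * (2 * (chainingConst d * √n)) := by
  have : Nonempty F := hne.to_subtype
  refine le_of_forall_pos_le_add fun η hη => ?_
  have hsel : ∀ e : Fin n → Bool, ∃ f ∈ F, ghostSup F (swapAt e p)
      ≤ |∑ i, sgn (e i) * (f (p.1 i) - f (p.2 i))| + η / 2 ^ n := fun e => by
    rw [ghostSup_swapAt]
    obtain ⟨f, hf⟩ := exists_lt_of_lt_ciSup (sub_lt_self
      (⨆ f : F, |∑ i, sgn (e i) * (f.1 (p.1 i) - f.1 (p.2 i))|) (by positivity : 0 < η / 2 ^ n))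
    exact ⟨f.1, f.2, by linarith⟩
  choose f hf hle using hsel
  have h1 := sum_abs_rademacher_class_le hF hd p.1 f hf
  have h2 := sum_abs_rademacher_class_le hF hd p.2 f hf
  simp only [Fintype.card_fin] at h1 h2
  calc _ ≤ ∑ e : Fin n → Bool, (|∑ i, sgn (e i) * f e (p.1 i)| + |∑ i, sgn (e i) * f e (p.2 i)|
          + η / 2 ^ n) := by
        refine Finset.sum_le_sum fun e _ => (hle e).trans ?_
        simp only [mul_sub, Finset.sum_sub_distrib]
        gcongr
        exact abs_sub _ _
    _ ≤ _ := by
        rw [Finset.sum_add_distrib, Finset.sum_add_distrib, Finset.sum_const, nsmul_eq_mul]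
        have h3 : (((Finset.univ : Finset (Fin n → Bool)).card : ℕ) : ℝ) * (η / 2 ^ n) = η := by
          simp; field_simp
        rw [h3]
        linarith

variable [MeasurableSpace 𝒵]

lemma measurePreserving_swapAt {n : ℕ} (P : Fin n → Measure 𝒵) [∀ i, IsProbabilityMeasure (P i)]
    (e : Fin n → Bool) :
    MeasurePreserving (swapAt e) ((Measure.pi P).prod (Measure.pi P))
      ((Measure.pi P).prod (Measure.pi P)) := by
  have h1 := measurePreserving_arrowProdEquivProdArrow 𝒵 𝒵 (Fin n) P P
  have h2 : MeasurePreserving (fun (w : Fin n → 𝒵 × 𝒵) i => if e i then w i else (w i).swap)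
      (Measure.pi fun i => (P i).prod (P i)) (Measure.pi fun i => (P i).prod (P i)) := by
    refine measurePreserving_pi (f := fun i (w : 𝒵 × 𝒵) => if e i then w else w.swap) _ _
      fun i => ?_
    cases e i
    · simpa using Measure.measurePreserving_swap
    · simpa using! MeasurePreserving.id _
  have h3 := (h1.comp h2).comp (h1.symm _)
  convert h3 using 1
  ext p i
  · simp only [swapAt, Function.comp]
    change _ = (if e i then (p.1 i, p.2 i) else (p.1 i, p.2 i).swap).1
    cases e i <;> simp
  · simp only [swapAt, Function.comp]
    change _ = (if e i then (p.1 i, p.2 i) else (p.1 i, p.2 i).swap).2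
    cases e i <;> simp

lemma measurePreserving_append {n : ℕ} (P : ℕ → Measure 𝒵) (τ : Fin n → ℕ)
    [∀ i, IsProbabilityMeasure (P (τ i))] :
    MeasurePreserving (fun p : (Fin n → 𝒵) × (Fin n → 𝒵) => Fin.append p.1 p.2)
      ((Measure.pi fun i => P (τ i)).prod (Measure.pi fun i => P (τ i)))
      (Measure.pi fun j => P (Fin.append τ τ j)) := by
  have hprob : ∀ j, IsProbabilityMeasure (P (Fin.append τ τ j)) := fun j => by
    refine Fin.addCases (fun i => ?_) (fun i => ?_) j
    · rw [Fin.append_left]; infer_instance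
    · rw [Fin.append_right]; infer_instance
  have hm : Measurable fun p : (Fin n → 𝒵) × (Fin n → 𝒵) => Fin.append p.1 p.2 := by
    refine measurable_pi_lambda _ fun j => ?_
    refine Fin.addCases (fun i => ?_) (fun i => ?_) j
    · simp only [Fin.append_left]; fun_prop
    · simp only [Fin.append_right]; fun_prop
  refine ⟨hm, (Measure.pi_eq fun s hs => ?_).symm⟩
  rw [Measure.map_apply hm (MeasurableSet.univ_pi hs)]
  have hpre : (fun p : (Fin n → 𝒵) × (Fin n → 𝒵) => Fin.append p.1 p.2) ⁻¹' Set.univ.pi s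
      = (Set.univ.pi fun i => s (Fin.castAdd n i)) ×ˢ (Set.univ.pi fun i => s (Fin.natAdd n i)) := by
    ext p
    simp only [Set.mem_preimage, Set.mem_univ_pi, Set.mem_prod]
    refine ⟨fun h => ⟨fun i => ?_, fun i => ?_⟩, fun h j => ?_⟩
    · simpa only [Fin.append_left] using h (Fin.castAdd n i)
    · simpa only [Fin.append_right] using h (Fin.natAdd n i)
    · refine Fin.addCases (fun i => ?_) (fun i => ?_) j
      · simpa only [Fin.append_left] using h.1 i
      · simpa only [Fin.append_right] using h.2 i
  rw [hpre, Measure.prod_prod, Measure.pi_pi, Measure.pi_pi, Fin.prod_univ_add]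
  simp only [Fin.append_left, Fin.append_right]

lemma aemeasurable_ghostSup {F : Set (𝒵 → ℝ)} {P : ℕ → Measure 𝒵} (hm : IsMeasurableClass F P)
    {n : ℕ} (τ : Fin n → ℕ) (hτ : ∀ i, 1 ≤ τ i) [∀ i, IsProbabilityMeasure (P (τ i))] :
    AEMeasurable (ghostSup F)
      ((Measure.pi fun i => P (τ i)).prod (Measure.pi fun i => P (τ i))) := by
  have h1 := hm (n + n) (Fin.append τ τ) (Fin.append (fun _ => 1) fun _ => -1)
    (fun j => by
      refine Fin.addCases (fun i => ?_) (fun i => ?_) j <;>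
        simp only [Fin.append_left, Fin.append_right, hτ])
    (fun j => by
      refine Fin.addCases (fun i => ?_) (fun i => ?_) j <;>
        simp only [Fin.append_left, Fin.append_right, true_or, or_true])
  have h2 := h1.comp_quasiMeasurePreserving (measurePreserving_append P τ).quasiMeasurePreserving
  convert h2 using 1
  ext p
  simp only [ghostSup, Function.comp, Fin.sum_univ_add, Fin.append_left, Fin.append_right, one_mul,
    neg_mul, sub_eq_add_neg, Finset.sum_add_distrib]

/-- The expected supremum for two independent samples: since the product measure is invariant
under exchanging the samples at any set of coordinates, random signs may be introduced. -/
theorem integral_ghostSup_le {F : Set (𝒵 → ℝ)} (hne : F.Nonempty)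
    (hF : ∀ f ∈ F, ∀ z, f z ∈ Set.Icc (0 : ℝ) 1) {d : ℕ}
    (hd : ∀ (k : ℕ) (z : Fin k → 𝒵) (w : Fin k → ℝ),
      Set.ncard {p : Fin k → Prop | ∃ f ∈ F, p = fun i => f (z i) ≤ w i} = 2 ^ k → k ≤ d)
    {n : ℕ} (P : Fin n → Measure 𝒵) [∀ i, IsProbabilityMeasure (P i)]
    (hm : AEMeasurable (ghostSup F) ((Measure.pi P).prod (Measure.pi P))) :
    ∫ p, ghostSup F p ∂((Measure.pi P).prod (Measure.pi P)) ≤ 2 * (chainingConst d * √n) := by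
  set ρ := (Measure.pi P).prod (Measure.pi P) with hρ
  have hme : ∀ e : Fin n → Bool, AEMeasurable (fun p => ghostSup F (swapAt e p)) ρ := fun e =>
    hm.comp_quasiMeasurePreserving (measurePreserving_swapAt P e).quasiMeasurePreserving
  have hie : ∀ e : Fin n → Bool, Integrable (fun p => ghostSup F (swapAt e p)) ρ := fun e =>
    Integrable.of_mem_Icc 0 n (hme e) (Eventually.of_forall fun p => ghostSup_mem_Icc hF _)
  have heq : ∀ e : Fin n → Bool,
      ∫ p, ghostSup F (swapAt e p) ∂ρ = ∫ p, ghostSup F p ∂ρ := fun e => by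
    have h1 := measurePreserving_swapAt P e
    have h2 := integral_map (μ := ρ) (φ := swapAt e) h1.measurable.aemeasurable (f := ghostSup F)
      (by rw [h1.map_eq]; exact hm.aestronglyMeasurable)
    rw [h1.map_eq] at h2
    exact h2.symm
  have hsum : 2 ^ n * ∫ p, ghostSup F p ∂ρ ≤ 2 ^ n * (2 * (chainingConst d * √n)) := by
    calc _ = ∑ e : Fin n → Bool, ∫ p, ghostSup F (swapAt e p) ∂ρ := by
          simp only [heq, Finset.sum_const, nsmul_eq_mul]
          simp
      _ = ∫ p, ∑ e : Fin n → Bool, ghostSup F (swapAt e p) ∂ρ :=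
          (integral_finsetSum _ fun e _ => hie e).symm
      _ ≤ ∫ _, 2 ^ n * (2 * (chainingConst d * √n)) ∂ρ :=
          integral_mono (integrable_finsetSum _ fun e _ => hie e) (integrable_const _)
            fun p => sum_ghostSup_swapAt_le hne hF hd p
      _ = _ := by simp
  exact le_of_mul_le_mul_left hsum (by positivity)

/-- A bounded almost everywhere measurable function has a measurable majorant which agrees with it
almost everywhere and has the same bound. -/
lemma exists_measurable_majorant {𝒰 : Type*} [MeasurableSpace 𝒰] {ρ : Measure 𝒰} {G : 𝒰 → ℝ}
    (hG : AEMeasurable G ρ) {c : ℝ} (hGc : ∀ x, G x ∈ Set.Icc 0 c) :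
    ∃ G' : 𝒰 → ℝ, Measurable G' ∧ (∀ x, G x ≤ G' x) ∧ (∀ x, G' x ∈ Set.Icc 0 c) ∧
      G' =ᵐ[ρ] G := by
  classical
  set N := toMeasurable ρ {x | ¬ G x = hG.mk G x} with hN
  have hNm : MeasurableSet N := measurableSet_toMeasurable _ _
  have hN0 : ρ N = 0 := by
    rw [hN, measure_toMeasurable]
    exact ae_iff.1 hG.ae_eq_mk
  have hout : ∀ x, x ∉ N → G x = hG.mk G x := fun x hx => by
    by_contra h
    exact hx (subset_toMeasurable ρ _ h)
  refine ⟨N.piecewise (fun _ => c) (hG.mk G),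
    Measurable.piecewise hNm measurable_const hG.measurable_mk, fun x => ?_, fun x => ?_, ?_⟩
  · by_cases hx : x ∈ N
    · rw [Set.piecewise_eq_of_mem _ _ _ hx]; exact (hGc x).2
    · rw [Set.piecewise_eq_of_notMem _ _ _ hx, hout x hx]
  · by_cases hx : x ∈ N
    · rw [Set.piecewise_eq_of_mem _ _ _ hx]
      exact ⟨(hGc x).1.trans (hGc x).2, le_rfl⟩
    · rw [Set.piecewise_eq_of_notMem _ _ _ hx, ← hout x hx]; exact hGc x
  · have : ∀ᵐ x ∂ρ, x ∉ N := measure_eq_zero_iff_ae_notMem.1 hN0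
    filter_upwards [this] with x hx
    rw [Set.piecewise_eq_of_notMem _ _ _ hx, hout x hx]

end Symmetrization

/-! ### Generalization error of a data-dependent function -/

section Generalization

variable {Ω 𝒵 : Type*} [MeasurableSpace Ω] [MeasurableSpace 𝒵] (μ : Measure Ω)
  [IsProbabilityMeasure μ] {Z : ℕ → Ω → 𝒵}

/-- The expected generalization error of any measurably chosen function of the class, on
observations at times at least `k` apart. The supremum over the class need not be measurable for
the joint law of the observations, so it is replaced by a measurable majorant before the joint law
is compared with the product law. -/
theorem integral_generalization_le (hZ : ∀ t, 1 ≤ t → Measurable (Z t))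
    {F : Set (𝒵 → ℝ)} (hne : F.Nonempty) (hFm : ∀ f ∈ F, Measurable f)
    (hF : ∀ f ∈ F, ∀ z, f z ∈ Set.Icc (0 : ℝ) 1)
    (hclass : IsMeasurableClass F fun t => μ.map (Z t)) {d : ℕ}
    (hd : ∀ (k : ℕ) (z : Fin k → 𝒵) (w : Fin k → ℝ),
      Set.ncard {p : Fin k → Prop | ∃ f ∈ F, p = fun i => f (z i) ≤ w i} = 2 ^ k → k ≤ d)
    {n : ℕ} (hn : 0 < n) (k : ℕ) (τ : Fin n → ℕ) (hτ : ∀ i, 1 ≤ τ i)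
    (hgap : ∀ i j, i < j → τ i + k ≤ τ j)
    (g : Ω → 𝒵 → ℝ) (hg : ∀ ω, g ω ∈ F) (hgm : Measurable fun p : Ω × 𝒵 => g p.1 p.2) :
    ∫ ω, ∑ i, ((∫ z, g ω z ∂(μ.map (Z (τ i)))) - g ω (Z (τ i) ω)) ∂μ
      ≤ 2 * (chainingConst d * √n) + n * (n * betaMix μ Z k) := by
  have hP : ∀ i, IsProbabilityMeasure (μ.map (Z (τ i))) := fun i =>
    Measure.isProbabilityMeasure_map (hZ _ (hτ i)).aemeasurable
  set Q := Measure.pi fun i => μ.map (Z (τ i)) with hQ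
  have hY : Measurable fun ω i => Z (τ i) ω := measurable_pi_lambda _ fun i => hZ _ (hτ i)
  have hPY : IsProbabilityMeasure (μ.map fun ω i => Z (τ i) ω) :=
    Measure.isProbabilityMeasure_map hY.aemeasurable
  have hn0 : (0 : ℝ) < n := by exact_mod_cast hn
  have hGm : AEMeasurable (ghostSup F) (Q.prod Q) :=
    aemeasurable_ghostSup (P := fun t => μ.map (Z t)) hclass τ hτ
  obtain ⟨G, hGmeas, hGle, hG01, hGae⟩ := exists_measurable_majorant hGm
    fun p => ghostSup_mem_Icc (n := n) hF p
  have hGi : Integrable G (Q.prod Q) :=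
    Integrable.of_mem_Icc 0 n hGmeas.aemeasurable (Eventually.of_forall hG01)
  have hGx : ∀ y, Integrable (fun x => G (x, y)) Q := fun y =>
    Integrable.of_mem_Icc 0 n (by fun_prop) (Eventually.of_forall fun x => hG01 _)
  -- the conditional expectation of the majorant over the ghost sample
  set h : (Fin n → 𝒵) → ℝ := fun y => ∫ x, G (x, y) ∂Q with hh
  have hhm : Measurable h := by
    have : StronglyMeasurable fun p : (Fin n → 𝒵) × (Fin n → 𝒵) => G (p.2, p.1) :=
      (hGmeas.comp measurable_swap).stronglyMeasurable
    exact (StronglyMeasurable.integral_prod_right (f := fun y x => G (x, y)) this).measurable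
  have hh01 : ∀ y, h y ∈ Set.Icc (0 : ℝ) n := fun y => by
    refine ⟨integral_nonneg fun x => (hG01 _).1, ?_⟩
    calc h y ≤ ∫ _, (n : ℝ) ∂Q := integral_mono (hGx y) (integrable_const _) fun x => (hG01 _).2
      _ = n := by simp
  have hpoint : ∀ ω, ∑ i, ((∫ z, g ω z ∂(μ.map (Z (τ i)))) - g ω (Z (τ i) ω))
      ≤ h fun i => Z (τ i) ω := fun ω => by
    have hgi : ∀ i, Integrable (fun x : Fin n → 𝒵 => g ω (x i)) Q := fun i =>
      Integrable.of_mem_Icc 0 1 (((hFm _ (hg ω)).comp (measurable_pi_apply i)).aemeasurable)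
        (Eventually.of_forall fun x => hF _ (hg ω) _)
    calc _ = ∫ x, ∑ i, (g ω (x i) - g ω (Z (τ i) ω)) ∂Q := by
          rw [integral_finsetSum (f := fun i (x : Fin n → 𝒵) => g ω (x i) - g ω (Z (τ i) ω)) _
            fun i _ => (hgi i).sub (integrable_const _)]
          refine Finset.sum_congr rfl fun i _ => ?_
          rw [integral_sub (hgi i) (integrable_const _), hQ,
            integral_comp_eval (hFm _ (hg ω)).aestronglyMeasurable]
          simp
      _ ≤ _ := by
          refine integral_mono (integrable_finsetSum _ fun i _ =>
            (hgi i).sub (integrable_const _)) (hGx _) fun x => ?_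
          exact (le_ghostSup hF (x, fun i => Z (τ i) ω) (hg ω)).trans (hGle _)
  have hint1 : ∀ i, Integrable (fun ω => ∫ z, g ω z ∂(μ.map (Z (τ i)))) μ := fun i => by
    refine Integrable.of_mem_Icc 0 1 ?_ (Eventually.of_forall fun ω => ?_)
    · exact (StronglyMeasurable.integral_prod_right (f := g)
        hgm.stronglyMeasurable).measurable.aemeasurable
    · refine ⟨integral_nonneg fun z => (hF _ (hg ω) z).1, ?_⟩
      calc _ ≤ ∫ _, (1 : ℝ) ∂(μ.map (Z (τ i))) :=
            integral_mono (Integrable.of_mem_Icc 0 1 (hFm _ (hg ω)).aemeasurable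
              (Eventually.of_forall fun z => hF _ (hg ω) z)) (integrable_const _)
              fun z => (hF _ (hg ω) z).2
        _ = 1 := by simp
  have hint2 : ∀ i, Integrable (fun ω => g ω (Z (τ i) ω)) μ := fun i =>
    Integrable.of_mem_Icc 0 1
      (hgm.comp (measurable_id.prodMk (hZ _ (hτ i)))).aemeasurable
      (Eventually.of_forall fun ω => hF _ (hg ω) _)
  have hhY : Integrable (fun ω => h fun i => Z (τ i) ω) μ :=
    Integrable.of_mem_Icc 0 n (hhm.comp hY).aemeasurable (Eventually.of_forall fun ω => hh01 _)
  have hmain : ∫ ω, ∑ i, ((∫ z, g ω z ∂(μ.map (Z (τ i)))) - g ω (Z (τ i) ω)) ∂μ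
      ≤ ∫ y, h y ∂(μ.map fun ω i => Z (τ i) ω) := by
    rw [integral_map hY.aemeasurable hhm.aestronglyMeasurable]
    exact integral_mono (integrable_finsetSum _ fun i _ => (hint1 i).sub (hint2 i)) hhY hpoint
  have hdec := integral_le_add_of_measure_le
    (mul_nonneg n.cast_nonneg (betaMix_nonneg μ k) : 0 ≤ (n : ℝ) * betaMix μ Z k)
    (law_le_pi_add_betaMix μ hZ k n τ hτ hgap) (g := fun y => h y / n) (hhm.div_const _)
    fun y => ⟨div_nonneg (hh01 y).1 hn0.le, (div_le_one hn0).2 (hh01 y).2⟩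
  rw [integral_div, integral_div, div_le_iff₀ hn0, add_mul, div_mul_cancel₀ _ hn0.ne'] at hdec
  have hghost : ∫ y, h y ∂Q ≤ 2 * (chainingConst d * √n) := by
    have h1 : ∫ y, h y ∂Q = ∫ p, G p ∂(Q.prod Q) := (integral_prod_symm G hGi).symm
    rw [h1, integral_congr_ae hGae]
    exact integral_ghostSup_le hne hF hd _ hGm
  linarith

end Generalization

/-! ### The excess risk at a fixed time -/

section ExcessRisk

variable {Ω 𝒵 : Type*} [MeasurableSpace Ω] [MeasurableSpace 𝒵] (μ : Measure Ω)
  [IsProbabilityMeasure μ] {Z : ℕ → Ω → 𝒵}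

lemma integral_joint_le_add_betaMix (hZ : ∀ t, 1 ≤ t → Measurable (Z t)) {k ℓ : ℕ} (hℓ : 1 ≤ ℓ)
    {𝒰 𝒱 : Type*} {m𝒰 : MeasurableSpace 𝒰} {m𝒱 : MeasurableSpace 𝒱} {U : Ω → 𝒰} {V : Ω → 𝒱}
    (hU : Measurable[sigmaGen Z (Set.Icc 1 ℓ)] U)
    (hV : Measurable[sigmaGen Z (Set.Ici (ℓ + k))] V) {g : 𝒰 → 𝒱 → ℝ}
    (hg : Measurable fun p : 𝒰 × 𝒱 => g p.1 p.2) (hg01 : ∀ u v, g u v ∈ Set.Icc (0 : ℝ) 1) :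
    ∫ ω, g (U ω) (V ω) ∂μ ≤ ∫ ω, ∫ v, g (U ω) v ∂(μ.map V) ∂μ + betaMix μ Z k := by
  have hU' : Measurable U := hU.mono (sigmaGen_le fun t ht => hZ t ht.1) le_rfl
  have hV' : Measurable V :=
    hV.mono (sigmaGen_le fun t ht => hZ t (by have := Set.mem_Ici.1 ht; omega)) le_rfl
  have hUV : Measurable fun ω => (U ω, V ω) := hU'.prodMk hV'
  have : IsProbabilityMeasure (μ.map U) := Measure.isProbabilityMeasure_map hU'.aemeasurable
  have : IsProbabilityMeasure (μ.map V) := Measure.isProbabilityMeasure_map hV'.aemeasurable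
  have : IsProbabilityMeasure (μ.map fun ω => (U ω, V ω)) :=
    Measure.isProbabilityMeasure_map hUV.aemeasurable
  have h1 := integral_le_add_of_measure_le (betaMix_nonneg μ k)
    (fun C hC => joint_le_prod_add_betaMix μ hZ hℓ hU hV hC) hg fun p => hg01 _ _
  have hi : Integrable (fun p : 𝒰 × 𝒱 => g p.1 p.2) ((μ.map U).prod (μ.map V)) :=
    Integrable.of_mem_Icc 0 1 hg.aemeasurable (Eventually.of_forall fun p => hg01 _ _)
  rwa [integral_map hUV.aemeasurable hg.aestronglyMeasurable, integral_prod _ hi,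
    integral_map hU'.aemeasurable
      (StronglyMeasurable.integral_prod_right (f := g) hg.stronglyMeasurable).aestronglyMeasurable]
    at h1

/-- A function chosen from the past has nearly the same expected value at the observation `V` in
the future as at an independent copy of `V`. -/
theorem abs_integral_joint_sub_le_betaMix (hZ : ∀ t, 1 ≤ t → Measurable (Z t)) {k ℓ : ℕ}
    (hℓ : 1 ≤ ℓ) {𝒰 𝒱 : Type*} {m𝒰 : MeasurableSpace 𝒰} {m𝒱 : MeasurableSpace 𝒱} {U : Ω → 𝒰}
    {V : Ω → 𝒱} (hU : Measurable[sigmaGen Z (Set.Icc 1 ℓ)] U)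
    (hV : Measurable[sigmaGen Z (Set.Ici (ℓ + k))] V) {g : 𝒰 → 𝒱 → ℝ}
    (hg : Measurable fun p : 𝒰 × 𝒱 => g p.1 p.2) (hg01 : ∀ u v, g u v ∈ Set.Icc (0 : ℝ) 1) :
    |∫ ω, g (U ω) (V ω) ∂μ - ∫ ω, ∫ v, g (U ω) v ∂(μ.map V) ∂μ| ≤ betaMix μ Z k := by
  have hU' : Measurable U := hU.mono (sigmaGen_le fun t ht => hZ t ht.1) le_rfl
  have hV' : Measurable V :=
    hV.mono (sigmaGen_le fun t ht => hZ t (by have := Set.mem_Ici.1 ht; omega)) le_rfl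
  have : IsProbabilityMeasure (μ.map V) := Measure.isProbabilityMeasure_map hV'.aemeasurable
  have h1 := integral_joint_le_add_betaMix μ hZ hℓ hU hV hg hg01
  have h2 := integral_joint_le_add_betaMix μ hZ hℓ hU hV (g := fun u v => 1 - g u v)
    (measurable_const.sub hg)
    fun u v => ⟨by linarith [(hg01 u v).2], by linarith [(hg01 u v).1]⟩
  have hgu : ∀ u, Integrable (fun v => g u v) (μ.map V) := fun u =>
    Integrable.of_mem_Icc 0 1 (hg.comp measurable_prodMk_left).aemeasurable
      (Eventually.of_forall fun v => hg01 u v)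
  have hi1 : Integrable (fun ω => g (U ω) (V ω)) μ :=
    Integrable.of_mem_Icc 0 1 (hg.comp (hU'.prodMk hV')).aemeasurable
      (Eventually.of_forall fun ω => hg01 _ _)
  have hi2 : Integrable (fun ω => ∫ v, g (U ω) v ∂(μ.map V)) μ := by
    refine Integrable.of_mem_Icc 0 1
      ((StronglyMeasurable.integral_prod_right (f := g)
        hg.stronglyMeasurable).measurable.comp hU').aemeasurable
      (Eventually.of_forall fun ω => ⟨integral_nonneg fun v => (hg01 _ v).1, ?_⟩)
    calc _ ≤ ∫ _, (1 : ℝ) ∂(μ.map V) :=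
          integral_mono (hgu _) (integrable_const _) fun v => (hg01 _ v).2
      _ = 1 := by simp
  have h3 : ∀ u, ∫ v, (1 - g u v) ∂(μ.map V) = 1 - ∫ v, g u v ∂(μ.map V) := fun u => by
    rw [integral_sub (integrable_const _) (hgu u)]; simp
  simp only [h3] at h2
  rw [integral_sub (integrable_const _) hi1, integral_sub (integrable_const _) hi2] at h2
  rw [abs_le]
  constructor <;> linarith

lemma integral_mem_Icc {F : Set (𝒵 → ℝ)} (hFm : ∀ f ∈ F, Measurable f)
    (hF : ∀ f ∈ F, ∀ z, f z ∈ Set.Icc (0 : ℝ) 1) (P : Measure 𝒵) [IsProbabilityMeasure P]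
    {f : 𝒵 → ℝ} (hf : f ∈ F) : ∫ z, f z ∂P ∈ Set.Icc (0 : ℝ) 1 := by
  refine ⟨integral_nonneg fun z => (hF f hf z).1, ?_⟩
  calc _ ≤ ∫ _, (1 : ℝ) ∂P :=
        integral_mono (Integrable.of_mem_Icc 0 1 (hFm f hf).aemeasurable
          (Eventually.of_forall (hF f hf))) (integrable_const _) fun z => (hF f hf z).2
    _ = 1 := by simp

/-- The drift between two times is at most the sum of the one-step drifts between them. -/
lemma abs_integral_sub_le_sum_drift (hZ : ∀ t, 1 ≤ t → Measurable (Z t))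
    {F : Set (𝒵 → ℝ)} (hFm : ∀ f ∈ F, Measurable f)
    (hF : ∀ f ∈ F, ∀ z, f z ∈ Set.Icc (0 : ℝ) 1) {Δ : ℕ → ℝ}
    (hΔ : ∀ t, 2 ≤ t → discrepancy F (μ.map (Z t)) (μ.map (Z (t - 1))) ≤ Δ t)
    {f : 𝒵 → ℝ} (hf : f ∈ F) {a : ℕ} (ha : 1 ≤ a) {t : ℕ} (hat : a ≤ t) :
    |∫ z, f z ∂(μ.map (Z t)) - ∫ z, f z ∂(μ.map (Z a))| ≤ ∑ u ∈ Finset.Ioc a t, Δ u := by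
  induction t, hat using Nat.le_induction with
  | base => simp
  | succ t hat ih =>
    have hP : ∀ s, 1 ≤ s → IsProbabilityMeasure (μ.map (Z s)) := fun s hs =>
      Measure.isProbabilityMeasure_map (hZ s hs).aemeasurable
    have := hP t (ha.trans hat)
    have := hP (t + 1) (by omega)
    have hbdd : BddAbove (Set.range fun f : F =>
        |(∫ z, f.1 z ∂(μ.map (Z (t + 1)))) - ∫ z, f.1 z ∂(μ.map (Z t))|) := by
      refine ⟨1, ?_⟩
      rintro _ ⟨g, rfl⟩
      have h1 := integral_mem_Icc hFm hF (μ.map (Z (t + 1))) g.2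
      have h2 := integral_mem_Icc hFm hF (μ.map (Z t)) g.2
      exact abs_le.2 ⟨by linarith [h1.1, h2.2], by linarith [h1.2, h2.1]⟩
    have hstep : |∫ z, f z ∂(μ.map (Z (t + 1))) - ∫ z, f z ∂(μ.map (Z t))| ≤ Δ (t + 1) :=
      (le_ciSup hbdd (⟨f, hf⟩ : F)).trans (hΔ (t + 1) (by omega))
    rw [← Finset.insert_Ioc_right_eq_Ioc_add_one hat, Finset.sum_insert (by simp)]
    calc _ ≤ _ := abs_sub_le _ (∫ z, f z ∂(μ.map (Z t))) _
      _ ≤ _ := add_le_add hstep ih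

/-- The observations at the times `t - s * k`, listed in increasing order of time. -/
lemma sum_Icc_eq_sum_fin {E : Type*} [AddCommMonoid E] (φ : ℕ → E) (M t k : ℕ) :
    ∑ s ∈ Finset.Icc 1 M, φ (t - s * k) = ∑ i : Fin M, φ (t - (M - i) * k) := by
  rw [Fin.sum_univ_eq_sum_range (fun i => φ (t - (M - i) * k)) M,
    ← Finset.sum_range_reflect (fun i => φ (t - (M - i) * k)) M,
    Finset.sum_bij' (i := fun s _ => s - 1) (j := fun i _ => i + 1)]
  · intro s hs; rw [Finset.mem_Icc] at hs; rw [Finset.mem_range]; omega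
  · intro i hi; rw [Finset.mem_range] at hi; rw [Finset.mem_Icc]; omega
  · intro s hs; rw [Finset.mem_Icc] at hs; omega
  · intro i hi; omega
  · intro s hs
    rw [Finset.mem_Icc] at hs
    have : M - (M - 1 - (s - 1)) = s := by omega
    rw [this]

/-- The excess risk at time `t` of an empirical risk minimizer over `M` observations `k` apart,
all within the last `m` steps: a mixing term, the drift over the window, the stochastic error, and
the cost of decoupling the `M` observations. -/
theorem abs_excess_risk_le (hZ : ∀ t, 1 ≤ t → Measurable (Z t))
    {F : Set (𝒵 → ℝ)} (hne : F.Nonempty) (hFm : ∀ f ∈ F, Measurable f)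
    (hF : ∀ f ∈ F, ∀ z, f z ∈ Set.Icc (0 : ℝ) 1)
    (hclass : IsMeasurableClass F fun t => μ.map (Z t)) {d : ℕ}
    (hd : ∀ (k : ℕ) (z : Fin k → 𝒵) (w : Fin k → ℝ),
      Set.ncard {p : Fin k → Prop | ∃ f ∈ F, p = fun i => f (z i) ≤ w i} = 2 ^ k → k ≤ d)
    {Δ : ℕ → ℝ} (hΔ0 : ∀ t, 1 ≤ t → 0 ≤ Δ t)
    (hΔ : ∀ t, 2 ≤ t → discrepancy F (μ.map (Z t)) (μ.map (Z (t - 1))) ≤ Δ t)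
    {k m M t : ℕ} (hk : 1 ≤ k) (hM : 1 ≤ M) (hMm : M * k ≤ m) (hmt : m < t)
    (g : Ω → 𝒵 → ℝ) (hg : ∀ ω, g ω ∈ F)
    (hmin : ∀ ω, ∀ f ∈ F, ∑ s ∈ Finset.Icc 1 M, g ω (Z (t - s * k) ω)
      ≤ ∑ s ∈ Finset.Icc 1 M, f (Z (t - s * k) ω))
    (hgm : @Measurable (Ω × 𝒵) ℝ
      (@Prod.instMeasurableSpace Ω 𝒵 (sigmaGen Z (Set.Icc 1 (t - k))) inferInstance)
      inferInstance (fun p => g p.1 p.2)) :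
    |∫ ω, g ω (Z t ω) ∂μ - ⨅ f : F, ∫ ω, f.1 (Z t ω) ∂μ|
      ≤ betaMix μ Z k + 2 * ∑ u ∈ Finset.Ioc (t - m) t, Δ u + 2 * chainingConst d / √M
        + M * betaMix μ Z k := by
  have hkm : k ≤ m := (Nat.le_mul_of_pos_left k hM).trans hMm
  have : Nonempty F := hne.to_subtype
  have hM0 : (0 : ℝ) < M := by exact_mod_cast hM
  set τ : Fin M → ℕ := fun i => t - (M - i) * k with hτdef
  have hτle : ∀ i : Fin M, (M - i) * k ≤ m := fun i =>
    (Nat.mul_le_mul_right k (Nat.sub_le M i)).trans hMm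
  have hτ : ∀ i, 1 ≤ τ i := fun i => by have := hτle i; simp only [hτdef]; omega
  have hτm : ∀ i, t - m ≤ τ i := fun i => by have := hτle i; simp only [hτdef]; omega
  have hτt : ∀ i, τ i ≤ t := fun i => Nat.sub_le _ _
  have hgap : ∀ i j, i < j → τ i + k ≤ τ j := fun i j hij => by
    have h1 := hτle i
    have h2 : (M - j + 1) * k ≤ (M - i) * k := Nat.mul_le_mul_right k (by omega)
    rw [add_mul, one_mul] at h2
    simp only [hτdef]
    omega
  have hP : ∀ s, 1 ≤ s → IsProbabilityMeasure (μ.map (Z s)) := fun s hs =>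
    Measure.isProbabilityMeasure_map (hZ s hs).aemeasurable
  have hPt := hP t (by omega)
  have hPτ : ∀ i, IsProbabilityMeasure (μ.map (Z (τ i))) := fun i => hP _ (hτ i)
  have hpast : sigmaGen Z (Set.Icc 1 (t - k)) ≤ ‹MeasurableSpace Ω› :=
    sigmaGen_le fun s hs => hZ s hs.1
  have hgm' : Measurable fun p : Ω × 𝒵 => g p.1 p.2 :=
    hgm.mono (sup_le_sup (MeasurableSpace.comap_mono hpast) le_rfl) le_rfl
  set b := betaMix μ Z k with hb
  -- the risk of the chosen function at an independent copy of the observation at time `s`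
  set R : ℕ → ℝ := fun s => ∫ ω, ∫ z, g ω z ∂(μ.map (Z s)) ∂μ with hR
  have hRi : ∀ s, 1 ≤ s → Integrable (fun ω => ∫ z, g ω z ∂(μ.map (Z s))) μ := fun s hs => by
    have := hP s hs
    exact Integrable.of_mem_Icc 0 1 (StronglyMeasurable.integral_prod_right (f := g)
      hgm'.stronglyMeasurable).measurable.aemeasurable
      (Eventually.of_forall fun ω => integral_mem_Icc hFm hF _ (hg ω))
  have hmix : |∫ ω, g ω (Z t ω) ∂μ - R t| ≤ b := by
    refine @abs_integral_joint_sub_le_betaMix Ω 𝒵 _ _ μ _ Z hZ k (t - k) (by omega) Ω 𝒵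
      (sigmaGen Z (Set.Icc 1 (t - k))) _ id (Z t) measurable_id
      (measurable_sigmaGen ?_) g hgm fun ω z => hF _ (hg ω) z
    rw [Set.mem_Ici]; omega
  have hEf : ∀ f : F, ∀ s, 1 ≤ s → ∫ ω, f.1 (Z s ω) ∂μ = ∫ z, f.1 z ∂(μ.map (Z s)) :=
    fun f s hs => (integral_map (hZ s hs).aemeasurable (hFm _ f.2).aestronglyMeasurable).symm
  have hbelow : BddBelow (Set.range fun f : F => ∫ ω, f.1 (Z t ω) ∂μ) := by
    refine ⟨0, ?_⟩
    rintro _ ⟨f, rfl⟩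
    exact integral_nonneg fun ω => (hF _ f.2 _).1
  have hlow : ⨅ f : F, ∫ ω, f.1 (Z t ω) ∂μ ≤ R t := by
    have h1 : ∀ ω, ⨅ f : F, ∫ ω, f.1 (Z t ω) ∂μ ≤ ∫ z, g ω z ∂(μ.map (Z t)) := fun ω => by
      refine (ciInf_le hbelow (⟨g ω, hg ω⟩ : F)).trans_eq ?_
      exact hEf ⟨g ω, hg ω⟩ t (by omega)
    calc _ = ∫ _, ⨅ f : F, ∫ ω, f.1 (Z t ω) ∂μ ∂μ := by simp
      _ ≤ R t := integral_mono (integrable_const _) (hRi t (by omega)) h1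
  set D := ∑ u ∈ Finset.Ioc (t - m) t, Δ u with hD
  have hdrift : ∀ f ∈ F, ∀ i, |∫ z, f z ∂(μ.map (Z t)) - ∫ z, f z ∂(μ.map (Z (τ i)))| ≤ D :=
    fun f hf i => by
      refine (abs_integral_sub_le_sum_drift μ hZ hFm hF hΔ hf (hτ i) (hτt i)).trans ?_
      refine Finset.sum_le_sum_of_subset_of_nonneg (Finset.Ioc_subset_Ioc_left (hτm i)) ?_
      intro u hu _
      exact hΔ0 u (by have := (Finset.mem_Ioc.1 hu).1; omega)
  have hRdrift : ∀ i, R t ≤ R (τ i) + D := fun i => by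
    calc R t ≤ ∫ ω, (∫ z, g ω z ∂(μ.map (Z (τ i))) + D) ∂μ := by
          refine integral_mono (hRi t (by omega)) ((hRi _ (hτ i)).add (integrable_const _))
            fun ω => ?_
          have := (abs_le.1 (hdrift _ (hg ω) i)).2
          dsimp only
          linarith
      _ = _ := by rw [integral_add (hRi _ (hτ i)) (integrable_const _)]; simp [hR]
  have hgen := integral_generalization_le μ hZ hne hFm hF hclass hd hM k τ hτ hgap g hg hgm'
  have hgZ : ∀ i, Integrable (fun ω => g ω (Z (τ i) ω)) μ := fun i =>
    Integrable.of_mem_Icc 0 1 (hgm'.comp (measurable_id.prodMk (hZ _ (hτ i)))).aemeasurable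
      (Eventually.of_forall fun ω => hF _ (hg ω) _)
  have hup : ∀ f : F, R t - (2 * D + 2 * chainingConst d / √M + M * b)
      ≤ ∫ ω, f.1 (Z t ω) ∂μ := fun f => by
    have hfZ : ∀ i, Integrable (fun ω => f.1 (Z (τ i) ω)) μ := fun i =>
      Integrable.of_mem_Icc 0 1 ((hFm _ f.2).comp (hZ _ (hτ i))).aemeasurable
        (Eventually.of_forall fun ω => hF _ f.2 _)
    have hmin' : ∀ ω, ∑ i, g ω (Z (τ i) ω) ≤ ∑ i, f.1 (Z (τ i) ω) := fun ω => by
      have := hmin ω f.1 f.2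
      rwa [sum_Icc_eq_sum_fin (fun s => g ω (Z s ω)), sum_Icc_eq_sum_fin (fun s => f.1 (Z s ω))]
        at this
    have hsum : ∑ i, (R (τ i) - ∫ ω, f.1 (Z (τ i) ω) ∂μ)
        ≤ 2 * (chainingConst d * √M) + M * (M * b) := by
      refine le_trans ?_ hgen
      calc _ = ∫ ω, ∑ i, ((∫ z, g ω z ∂(μ.map (Z (τ i)))) - f.1 (Z (τ i) ω)) ∂μ := by
            rw [integral_finsetSum (f := fun i ω =>
              (∫ z, g ω z ∂(μ.map (Z (τ i)))) - f.1 (Z (τ i) ω)) _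
              fun i _ => (hRi _ (hτ i)).sub (hfZ i)]
            exact Finset.sum_congr rfl fun i _ => (integral_sub (hRi _ (hτ i)) (hfZ i)).symm
        _ ≤ _ := by
            refine integral_mono (integrable_finsetSum _ fun i _ => (hRi _ (hτ i)).sub (hfZ i))
              (integrable_finsetSum _ fun i _ => (hRi _ (hτ i)).sub (hgZ i)) fun ω => ?_
            have := hmin' ω
            simp only [Finset.sum_sub_distrib]
            linarith
    have hshift : M * (R t - ∫ ω, f.1 (Z t ω) ∂μ)
        ≤ ∑ i, (R (τ i) - ∫ ω, f.1 (Z (τ i) ω) ∂μ) + M * (2 * D) := by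
      have h1 : ∀ i : Fin M, R t - ∫ ω, f.1 (Z t ω) ∂μ
          ≤ (R (τ i) - ∫ ω, f.1 (Z (τ i) ω) ∂μ) + 2 * D := fun i => by
        have h2 := (abs_le.1 (hdrift _ f.2 i)).1
        rw [hEf f t (by omega), hEf f _ (hτ i)]
        linarith [hRdrift i]
      calc _ = ∑ _i : Fin M, (R t - ∫ ω, f.1 (Z t ω) ∂μ) := by
            rw [Finset.sum_const, Finset.card_univ, Fintype.card_fin, nsmul_eq_mul]
        _ ≤ _ := Finset.sum_le_sum fun i _ => h1 i
        _ = _ := by rw [Finset.sum_add_distrib]; simp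
    have hsq : √(M : ℝ) = M * (1 / √M) := by
      rw [mul_one_div]; exact (Real.div_sqrt).symm
    have htot : M * (R t - ∫ ω, f.1 (Z t ω) ∂μ)
        ≤ M * (2 * D + 2 * chainingConst d / √M + M * b) := by
      refine hshift.trans ((add_le_add hsum le_rfl).trans (le_of_eq ?_))
      conv_lhs => rw [hsq]
      ring
    have := le_of_mul_le_mul_left htot hM0
    linarith
  have hup' := le_ciInf hup
  rw [abs_le] at hmix ⊢
  have hc := chainingConst_nonneg d
  have hb0 : 0 ≤ b := betaMix_nonneg μ k
  have hD0 : 0 ≤ D := Finset.sum_nonneg fun u hu =>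
    hΔ0 u (by have := (Finset.mem_Ioc.1 hu).1; omega)
  have h3 : 0 ≤ 2 * chainingConst d / √M := by positivity
  have h4 : 0 ≤ M * b := by positivity
  constructor <;> linarith

end ExcessRisk

/-! ### Sizes of the gap and the window -/

section Sizes

lemma one_le_natCast_rpow {t : ℕ} (ht : 1 ≤ t) {c : ℝ} (hc : 0 ≤ c) : (1 : ℝ) ≤ (t : ℝ) ^ c :=
  Real.one_le_rpow (by exact_mod_cast ht) hc

lemma min_ceil_rpow_le (t : ℕ) (ht : 1 ≤ t) {c : ℝ} (hc : 0 ≤ c) :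
    ((min ⌈(t : ℝ) ^ c⌉₊ (t - 1) : ℕ) : ℝ) ≤ 2 * (t : ℝ) ^ c := by
  have h1 := one_le_natCast_rpow ht hc
  have h2 := Nat.ceil_lt_add_one (by positivity : 0 ≤ (t : ℝ) ^ c)
  have h3 : ((min ⌈(t : ℝ) ^ c⌉₊ (t - 1) : ℕ) : ℝ) ≤ (⌈(t : ℝ) ^ c⌉₊ : ℝ) := by
    exact_mod_cast min_le_left _ _
  linarith

lemma le_min_ceil_rpow (t : ℕ) (ht : 2 ≤ t) {c : ℝ} (hc1 : c ≤ 1) :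
    (t : ℝ) ^ c / 2 ≤ ((min ⌈(t : ℝ) ^ c⌉₊ (t - 1) : ℕ) : ℝ) := by
  have ht' : (2 : ℝ) ≤ t := by exact_mod_cast ht
  have h1 : (t : ℝ) ^ c ≤ t := by
    calc (t : ℝ) ^ c ≤ (t : ℝ) ^ (1 : ℝ) := Real.rpow_le_rpow_of_exponent_le (by linarith) hc1
      _ = t := Real.rpow_one _
  have h0 : 0 ≤ (t : ℝ) ^ c := by positivity
  rw [Nat.cast_min, Nat.cast_sub (by omega), Nat.cast_one]
  refine le_min ?_ ?_
  · linarith [Nat.le_ceil ((t : ℝ) ^ c)]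
  · linarith

lemma one_le_gap {α r : ℝ} {t : ℕ} (ht : 2 ≤ t) : 1 ≤ gap α r t := by
  have ht' : (0 : ℝ) < t := by exact_mod_cast (by omega : 0 < t)
  exact le_min (Nat.one_le_ceil_iff.2 (Real.rpow_pos_of_pos ht' _)) (by omega)

lemma gap_le_window {α r : ℝ} (hα : α < 1) (hr : 0 < r) {t : ℕ} (ht : 1 ≤ t) :
    gap α r t ≤ window α r t := by
  have h1 : (1 - α) * (3 / (3 + 4 * r)) ≤ (1 - α) * ((3 + 2 * r) / (3 + 4 * r)) := by
    have : 0 ≤ 1 - α := by linarith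
    gcongr
    linarith
  exact min_le_min_right _ (Nat.ceil_mono
    (Real.rpow_le_rpow_of_exponent_le (by exact_mod_cast ht) h1))

/-- The number `⌊m / k⌋` of subsampled observations is of the order `m / k`. -/
lemma natCast_div_bounds {k m : ℕ} (hk : 1 ≤ k) (hkm : k ≤ m) {x y : ℝ} (hy : 0 < y)
    (hk1 : y / 2 ≤ k) (hk2 : (k : ℝ) ≤ 2 * y) (hm1 : x / 2 ≤ m) (hm2 : (m : ℝ) ≤ 2 * x) :
    x / y / 8 ≤ ((m / k : ℕ) : ℝ) ∧ ((m / k : ℕ) : ℝ) ≤ 4 * (x / y) := by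
  have hk0 : (0 : ℝ) < k := by exact_mod_cast hk
  have hM1 : 1 ≤ m / k := (Nat.one_le_div_iff hk).2 hkm
  have h1 : m < (m / k + 1) * k := by
    rw [mul_comm]; exact Nat.lt_mul_div_succ m hk
  have h2 : m / k * k ≤ m := Nat.div_mul_le_self m k
  have h1' : (m : ℝ) < ((m / k : ℕ) + 1) * k := by exact_mod_cast h1
  have h2' : ((m / k : ℕ) : ℝ) * k ≤ m := by exact_mod_cast h2
  have hM1' : (1 : ℝ) ≤ ((m / k : ℕ) : ℝ) := by exact_mod_cast hM1
  set M : ℝ := ((m / k : ℕ) : ℝ)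
  constructor
  · rw [div_div, div_le_iff₀ (by positivity)]
    nlinarith
  · rw [← mul_div_assoc, le_div_iff₀ hy]
    nlinarith

end Sizes

/-! ### Summation over time -/

section Summation

lemma sum_rpow_neg_le {κ : ℝ} (h0 : 0 ≤ κ) (h1 : κ < 1) (T : ℕ) :
    ∑ t ∈ Finset.Icc 1 T, (t : ℝ) ^ (-κ) ≤ (T : ℝ) ^ (1 - κ) / (1 - κ) := by
  have hκ : 0 < 1 - κ := by linarith
  induction T with
  | zero => simp [Real.zero_rpow hκ.ne']
  | succ T ih =>
    rw [Finset.sum_Icc_succ_top (by omega)]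
    set x : ℝ := ((T + 1 : ℕ) : ℝ) with hx
    have hx0 : 0 < x := by rw [hx]; positivity
    have hx1 : 1 ≤ x := by rw [hx]; push_cast; linarith [(T.cast_nonneg : (0 : ℝ) ≤ T)]
    have hT : (T : ℝ) = x * (1 + -(1 / x)) := by
      rw [hx]; field_simp; push_cast; ring
    have hs : -1 ≤ -(1 / x) := by
      rw [neg_le_neg_iff, div_le_one hx0]; exact hx1
    -- Bernoulli's inequality for the exponent `1 - κ ≤ 1`
    have hb := rpow_one_add_le_one_add_mul_self hs hκ.le (by linarith)
    have hpow : x ^ (1 - κ) = x * x ^ (-κ) := by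
      rw [sub_eq_add_neg, Real.rpow_add hx0, Real.rpow_one]
    have hstep : (T : ℝ) ^ (1 - κ) ≤ x ^ (1 - κ) - (1 - κ) * x ^ (-κ) := by
      rw [hT, Real.mul_rpow hx0.le (by linarith)]
      calc _ ≤ x ^ (1 - κ) * (1 + (1 - κ) * -(1 / x)) := by gcongr
        _ = _ := by rw [hpow]; field_simp; ring
    rw [le_div_iff₀ hκ] at ih ⊢
    rw [add_mul]
    linarith

/-- Each one-step drift is counted at most `W` times in windows of length at most `W`. -/
lemma sum_sum_window_le {Δ : ℕ → ℝ} (hΔ : ∀ t, 1 ≤ t → 0 ≤ Δ t) {m : ℕ → ℕ} {W T : ℕ}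
    (hm : ∀ t ∈ Finset.Icc 1 T, m t ≤ W) :
    ∑ t ∈ Finset.Icc 1 T, ∑ u ∈ Finset.Ioc (t - m t) t, Δ u
      ≤ W * ∑ u ∈ Finset.Icc 1 T, Δ u := by
  calc _ ≤ ∑ t ∈ Finset.Icc 1 T, ∑ u ∈ Finset.Icc 1 T,
        if t ∈ Finset.Ico u (u + W) then Δ u else 0 := by
        refine Finset.sum_le_sum fun t ht => ?_
        rw [← Finset.sum_filter]
        refine Finset.sum_le_sum_of_subset_of_nonneg (fun u hu => ?_) fun u hu _ =>
          hΔ u (Finset.mem_Icc.1 (Finset.mem_filter.1 hu).1).1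
        have hmt := hm t ht
        rw [Finset.mem_Icc] at ht
        rw [Finset.mem_Ioc] at hu
        rw [Finset.mem_filter, Finset.mem_Icc, Finset.mem_Ico]
        omega
    _ = ∑ u ∈ Finset.Icc 1 T, ∑ t ∈ Finset.Icc 1 T,
        if t ∈ Finset.Ico u (u + W) then Δ u else 0 := Finset.sum_comm
    _ ≤ ∑ u ∈ Finset.Icc 1 T, W * Δ u := by
        refine Finset.sum_le_sum fun u hu => ?_
        rw [← Finset.sum_filter, Finset.sum_const, nsmul_eq_mul]
        refine mul_le_mul_of_nonneg_right ?_ (hΔ u (Finset.mem_Icc.1 hu).1)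
        have : (Finset.Icc 1 T).filter (fun t => t ∈ Finset.Ico u (u + W)) ⊆ Finset.Ico u (u + W) :=
          fun t ht => (Finset.mem_filter.1 ht).2
        have h2 := Finset.card_le_card this
        rw [Nat.card_Ico, Nat.add_sub_cancel_left] at h2
        exact_mod_cast h2
    _ = _ := by rw [Finset.mul_sum]

lemma isLittleO_natCast_rpow {E : ℝ} (hE : E < 1) :
    (fun T : ℕ => (T : ℝ) ^ E) =o[atTop] fun T : ℕ => (T : ℝ) := by
  have h1 : (fun x : ℝ => x ^ E) =o[atTop] fun x : ℝ => x := by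
    refine (isLittleO_iff_tendsto' ?_).2 ?_
    · filter_upwards [eventually_gt_atTop 0] with x hx h
      exact absurd h hx.ne'
    · refine (tendsto_rpow_neg_atTop (by linarith : 0 < 1 - E)).congr' ?_
      filter_upwards [eventually_gt_atTop 0] with x hx
      rw [neg_sub, Real.rpow_sub hx, Real.rpow_one]
  exact h1.comp_tendsto tendsto_natCast_atTop_atTop

end Summation

/-! ### The rate -/

/-- The mixing, stochastic and decoupling errors at time `t` are all of the order `t ^ (-κ)` with
`κ = (1 - α) r / (3 + 4 r)`: the mixing coefficient at the gap is at most of the order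
`t ^ (-3 κ)`, and there are about `t ^ (2 κ)` subsampled observations. -/
lemma error_terms_le {α r : ℝ} (hα : α ∈ Set.Ico (0 : ℝ) 1) (hr : 0 < r) {β : ℕ → ℝ} {B C : ℝ}
    (hB : 0 ≤ B) (hC : 0 ≤ C) (hβ : ∀ k : ℕ, 1 ≤ k → β k ≤ B * (k : ℝ) ^ (-r)) {t : ℕ}
    (ht : 2 ≤ t) :
    β (gap α r t) + 2 * C / √(window α r t / gap α r t : ℕ)
        + (window α r t / gap α r t : ℕ) * β (gap α r t)
      ≤ (5 * (B * 2 ^ r) + 6 * C) * (t : ℝ) ^ (-((1 - α) * (r / (3 + 4 * r)))) := by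
  have ht0 : (0 : ℝ) < t := by exact_mod_cast (by omega : 0 < t)
  have hα0 : 0 < 1 - α := by linarith [hα.2]
  have hα1 : 1 - α ≤ 1 := by linarith [hα.1]
  have hden : 0 < 3 + 4 * r := by positivity
  set κ := (1 - α) * (r / (3 + 4 * r)) with hκ
  have hκ0 : 0 ≤ κ := by positivity
  set c₁ := (1 - α) * (3 / (3 + 4 * r)) with hc₁
  set c₂ := (1 - α) * ((3 + 2 * r) / (3 + 4 * r)) with hc₂
  have hc₁0 : 0 ≤ c₁ := by positivity
  have hc₂0 : 0 ≤ c₂ := by positivity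
  have hc₁1 : c₁ ≤ 1 := mul_le_one₀ hα1 (by positivity) ((div_le_one hden).2 (by linarith))
  have hc₂1 : c₂ ≤ 1 := mul_le_one₀ hα1 (by positivity) ((div_le_one hden).2 (by linarith))
  have hkey1 : c₂ - c₁ = κ + κ := by rw [hc₁, hc₂, hκ]; field_simp; ring
  have hkey2 : c₁ * r = 3 * κ := by rw [hc₁, hκ]; field_simp
  set k := gap α r t with hk
  set m := window α r t with hm
  set y := (t : ℝ) ^ c₁ with hy
  set x := (t : ℝ) ^ c₂ with hx
  have hy0 : 0 < y := Real.rpow_pos_of_pos ht0 _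
  have hk1 : 1 ≤ k := one_le_gap ht
  have hkm : k ≤ m := gap_le_window hα.2 hr (by omega)
  obtain ⟨hMlow, hMup⟩ := natCast_div_bounds hk1 hkm hy0 (le_min_ceil_rpow t ht hc₁1)
    (min_ceil_rpow_le t (by omega) hc₁0) (le_min_ceil_rpow t ht hc₂1)
    (min_ceil_rpow_le t (by omega) hc₂0)
  have hxy : x / y = (t : ℝ) ^ κ * (t : ℝ) ^ κ := by
    rw [hx, hy, ← Real.rpow_sub ht0, hkey1, Real.rpow_add ht0]
  rw [hxy] at hMlow hMup
  set M : ℝ := ((m / k : ℕ) : ℝ) with hMdef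
  set q := (t : ℝ) ^ κ with hq
  have hq1 : 1 ≤ q := one_le_natCast_rpow (by omega) hκ0
  have hq0 : 0 < q := by linarith
  have hneg : (t : ℝ) ^ (-κ) = 1 / q := by rw [Real.rpow_neg ht0.le, one_div]
  have hβk : β k ≤ B * 2 ^ r * (1 / (q * q * q)) := by
    refine (hβ k hk1).trans ?_
    rw [mul_assoc]
    refine mul_le_mul_of_nonneg_left ?_ hB
    calc (k : ℝ) ^ (-r) ≤ (y / 2) ^ (-r) :=
          Real.rpow_le_rpow_of_nonpos (by positivity) (le_min_ceil_rpow t ht hc₁1) (by linarith)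
      _ = 2 ^ r * (1 / (q * q * q)) := by
          rw [Real.div_rpow hy0.le (by norm_num), Real.rpow_neg (by norm_num : (0 : ℝ) ≤ 2),
            Real.rpow_neg hy0.le, hy, ← Real.rpow_mul ht0.le, hkey2,
            show 3 * κ = κ + κ + κ by ring, Real.rpow_add ht0, Real.rpow_add ht0, ← hq]
          field_simp
  have hB2 : 0 ≤ B * 2 ^ r := by positivity
  have hmix : β k ≤ B * 2 ^ r * (1 / q) := by
    refine hβk.trans (mul_le_mul_of_nonneg_left ?_ hB2)
    refine one_div_le_one_div_of_le hq0 ?_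
    nlinarith
  have hsto : 2 * C / √M ≤ 6 * C * (1 / q) := by
    have h1 : q / 3 ≤ √M := Real.le_sqrt_of_sq_le (by nlinarith)
    have h2 : 0 < √M := lt_of_lt_of_le (by positivity) h1
    rw [mul_one_div, div_le_div_iff₀ h2 hq0]
    nlinarith
  have hdec : M * β k ≤ 4 * (B * 2 ^ r) * (1 / q) := by
    calc M * β k ≤ M * (B * 2 ^ r * (1 / (q * q * q))) := by gcongr
      _ ≤ 4 * (q * q) * (B * 2 ^ r * (1 / (q * q * q))) := by gcongr
      _ = _ := by field_simp
  rw [hneg]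
  linarith

end DriftLearning

open DriftLearning

theorem theorem1 {Ω 𝒵 : Type*} [MeasurableSpace Ω] [MeasurableSpace 𝒵]
    (μ : Measure Ω) [IsProbabilityMeasure μ]
    (Z : ℕ → Ω → 𝒵) (hZ : ∀ t, 1 ≤ t → Measurable (Z t))
    (F : Set (𝒵 → ℝ))
    (hF : ∀ f ∈ F, Measurable f ∧ ∀ z, f z ∈ Set.Icc (0 : ℝ) 1)
    (hFmeas : DriftLearning.IsMeasurableClass F fun t => μ.map (Z t))
    (hd : DriftLearning.pseudoDim F < ⊤)
    (α : ℝ) (hα : α ∈ Set.Ico (0 : ℝ) 1)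
    (r : ℝ) (hr : 0 < r)
    (Δ : ℕ → ℝ) (hΔ1 : Δ 1 = 0)
    (hΔ : ∀ t, 2 ≤ t → Δ t ∈ Set.Icc (0 : ℝ) 1 ∧
      DriftLearning.discrepancy F (μ.map (Z t)) (μ.map (Z (t - 1))) ≤ Δ t)
    (hdrift : (fun T : ℕ => ∑ t ∈ Finset.Icc 1 T, Δ t) =O[atTop] fun T : ℕ => (T : ℝ) ^ α)
    (hbeta : (fun k : ℕ => DriftLearning.betaMix μ Z k) =O[atTop] fun k : ℕ => (k : ℝ) ^ (-r))
    (fhat : ℕ → Ω → 𝒵 → ℝ) (hfhat : DriftLearning.IsERM F α r Z fhat) :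
    ((fun T : ℕ => (∑ t ∈ Finset.Icc 1 T, ∫ ω, fhat t ω (Z t ω) ∂μ) -
        ∑ t ∈ Finset.Icc 1 T, ⨅ f : F, ∫ ω, f.1 (Z t ω) ∂μ)
      =O[atTop] fun T : ℕ => (T : ℝ) ^ (α + (1 - α) * ((3 + 3 * r) / (3 + 4 * r)))) ∧
    ((fun T : ℕ => (T : ℝ) ^ (α + (1 - α) * ((3 + 3 * r) / (3 + 4 * r))))
      =o[atTop] fun T : ℕ => (T : ℝ)) := by
  have hα0 : 0 < 1 - α := by linarith [hα.2]
  have hα1 : 1 - α ≤ 1 := by linarith [hα.1]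
  have hden : 0 < 3 + 4 * r := by positivity
  set κ := (1 - α) * (r / (3 + 4 * r)) with hκ
  have hκ0 : 0 < κ := by positivity
  have hκ1 : κ < 1 := by
    have : r / (3 + 4 * r) < 1 := (div_lt_one hden).2 (by linarith)
    nlinarith
  have hE : α + (1 - α) * ((3 + 3 * r) / (3 + 4 * r)) = 1 - κ := by
    rw [hκ]; field_simp; ring
  rw [hE]
  refine ⟨?_, isLittleO_natCast_rpow (by linarith)⟩
  have hFm : ∀ f ∈ F, Measurable f := fun f hf => (hF f hf).1
  have hF01 : ∀ f ∈ F, ∀ z, f z ∈ Set.Icc (0 : ℝ) 1 := fun f hf => (hF f hf).2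
  obtain ⟨f₁, hf₁, hinit⟩ := hfhat.init
  have hne : F.Nonempty := ⟨f₁, hf₁⟩
  have : Nonempty F := hne.to_subtype
  obtain ⟨d, hd'⟩ := exists_forall_shattered_le hd
  have hΔ0 : ∀ t, 1 ≤ t → 0 ≤ Δ t := fun t ht => by
    rcases Nat.eq_or_lt_of_le ht with rfl | ht'
    · exact hΔ1.ge
    · exact (hΔ t ht').1.1
  obtain ⟨B, hB0, hB⟩ := bound_of_isBigO_nat_atTop hbeta
  obtain ⟨A, hA0, hA⟩ := bound_of_isBigO_nat_atTop hdrift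
  have hβ : ∀ k : ℕ, 1 ≤ k → betaMix μ Z k ≤ B * (k : ℝ) ^ (-r) := fun k hk => by
    have hk0 : (0 : ℝ) < (k : ℝ) ^ (-r) := Real.rpow_pos_of_pos (by exact_mod_cast hk) _
    have := hB hk0.ne'
    rw [Real.norm_of_nonneg hk0.le] at this
    exact (le_abs_self _).trans this
  set K : ℝ := 5 * (B * 2 ^ r) + 6 * chainingConst d + 1 with hK
  have hC0 := chainingConst_nonneg d
  have hK1 : 1 ≤ K := by
    have : 0 ≤ 5 * (B * 2 ^ r) := by positivity
    linarith
  have hpoint : ∀ t, 1 ≤ t →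
      |∫ ω, fhat t ω (Z t ω) ∂μ - ⨅ f : F, ∫ ω, f.1 (Z t ω) ∂μ|
        ≤ K * (t : ℝ) ^ (-κ) + 2 * ∑ u ∈ Finset.Ioc (t - window α r t) t, Δ u := by
    intro t ht
    rcases Nat.eq_or_lt_of_le ht with rfl | ht'
    · have hP1 : IsProbabilityMeasure (μ.map (Z 1)) :=
        Measure.isProbabilityMeasure_map (hZ 1 le_rfl).aemeasurable
      have hval : ∀ f : F, ∫ ω, f.1 (Z 1 ω) ∂μ ∈ Set.Icc (0 : ℝ) 1 := fun f => by
        rw [← integral_map (hZ 1 le_rfl).aemeasurable (hFm _ f.2).aestronglyMeasurable]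
        exact integral_mem_Icc hFm hF01 _ f.2
      have hbelow : BddBelow (Set.range fun f : F => ∫ ω, f.1 (Z 1 ω) ∂μ) :=
        ⟨0, by rintro _ ⟨f, rfl⟩; exact (hval f).1⟩
      have h1 := hval ⟨f₁, hf₁⟩
      have h2 := ciInf_le hbelow (⟨f₁, hf₁⟩ : F)
      have h3 : 0 ≤ ⨅ f : F, ∫ ω, f.1 (Z 1 ω) ∂μ := le_ciInf fun f => (hval f).1
      have h4 : 0 ≤ ∑ u ∈ Finset.Ioc (1 - window α r 1) 1, Δ u := Finset.sum_nonneg fun u hu =>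
        hΔ0 u (by have := (Finset.mem_Ioc.1 hu).1; omega)
      simp only [hinit, Nat.cast_one, Real.one_rpow, mul_one]
      dsimp only at h1 h2
      rw [abs_of_nonneg (by linarith)]
      linarith [h1.2]
    · have hk1 : 1 ≤ gap α r t := one_le_gap ht'
      have hkm : gap α r t ≤ window α r t := gap_le_window hα.2 hr ht
      have hwt : window α r t < t := by
        have : window α r t ≤ t - 1 := min_le_right _ _
        omega
      have h1 := abs_excess_risk_le μ hZ hne hFm hF01 hFmeas hd' hΔ0 (fun t ht => (hΔ t ht).2)
        hk1 ((Nat.one_le_div_iff hk1).2 hkm) (Nat.div_mul_le_self _ _) hwt (fhat t)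
        (hfhat.mem t ht') (hfhat.isMin t ht') (hfhat.measurable t ht')
      have h2 := error_terms_le hα hr hB0.le hC0 hβ ht'
      have h3 : 0 ≤ (t : ℝ) ^ (-κ) := by positivity
      have h4 : K * (t : ℝ) ^ (-κ)
          = (5 * (B * 2 ^ r) + 6 * chainingConst d) * (t : ℝ) ^ (-κ) + (t : ℝ) ^ (-κ) := by
        rw [hK]; ring
      linarith
  refine IsBigO.of_bound (K / (1 - κ) + 4 * A) ?_
  filter_upwards [eventually_ge_atTop 1] with T hT
  have hT0 : (0 : ℝ) < T := by exact_mod_cast hT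
  set c₂ := (1 - α) * ((3 + 2 * r) / (3 + 4 * r)) with hc₂
  have hc₂0 : 0 ≤ c₂ := by positivity
  have hcα : c₂ + α ≤ 1 - κ := by
    rw [← hE, hc₂, add_comm]
    gcongr
    linarith
  set W : ℕ := ⌊2 * (T : ℝ) ^ c₂⌋₊ with hW
  have hwin : ∀ t ∈ Finset.Icc 1 T, window α r t ≤ W := fun t ht => by
    obtain ⟨ht1, htT⟩ := Finset.mem_Icc.1 ht
    refine Nat.le_floor ((min_ceil_rpow_le t ht1 hc₂0).trans ?_)
    have : (t : ℝ) ≤ T := by exact_mod_cast htT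
    gcongr
  have hΔsum : ∑ u ∈ Finset.Icc 1 T, Δ u ≤ A * (T : ℝ) ^ α := by
    have h0 : (0 : ℝ) < (T : ℝ) ^ α := Real.rpow_pos_of_pos hT0 _
    have := hA h0.ne'
    rw [Real.norm_of_nonneg h0.le] at this
    exact (le_abs_self _).trans this
  have hdr : ∑ t ∈ Finset.Icc 1 T, ∑ u ∈ Finset.Ioc (t - window α r t) t, Δ u
      ≤ 2 * A * (T : ℝ) ^ (1 - κ) := by
    calc _ ≤ W * ∑ u ∈ Finset.Icc 1 T, Δ u := sum_sum_window_le hΔ0 hwin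
      _ ≤ (2 * (T : ℝ) ^ c₂) * (A * (T : ℝ) ^ α) := by
          have hW2 : (W : ℝ) ≤ 2 * (T : ℝ) ^ c₂ := Nat.floor_le (by positivity)
          have : 0 ≤ ∑ u ∈ Finset.Icc 1 T, Δ u :=
            Finset.sum_nonneg fun u hu => hΔ0 u (Finset.mem_Icc.1 hu).1
          gcongr
      _ = 2 * A * (T : ℝ) ^ (c₂ + α) := by rw [Real.rpow_add hT0]; ring
      _ ≤ _ := by
          have : (1 : ℝ) ≤ T := by exact_mod_cast hT
          gcongr
  have hTκ : (0 : ℝ) ≤ (T : ℝ) ^ (1 - κ) := by positivity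
  rw [Real.norm_of_nonneg hTκ, ← Finset.sum_sub_distrib, Real.norm_eq_abs]
  calc _ ≤ ∑ t ∈ Finset.Icc 1 T,
        |∫ ω, fhat t ω (Z t ω) ∂μ - ⨅ f : F, ∫ ω, f.1 (Z t ω) ∂μ| :=
        Finset.abs_sum_le_sum_abs _ _
    _ ≤ ∑ t ∈ Finset.Icc 1 T, (K * (t : ℝ) ^ (-κ)
          + 2 * ∑ u ∈ Finset.Ioc (t - window α r t) t, Δ u) :=
        Finset.sum_le_sum fun t ht => hpoint t (Finset.mem_Icc.1 ht).1
    _ = K * ∑ t ∈ Finset.Icc 1 T, (t : ℝ) ^ (-κ)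
          + 2 * ∑ t ∈ Finset.Icc 1 T, ∑ u ∈ Finset.Ioc (t - window α r t) t, Δ u := by
        rw [Finset.sum_add_distrib, Finset.mul_sum, Finset.mul_sum]
    _ ≤ K * ((T : ℝ) ^ (1 - κ) / (1 - κ)) + 2 * (2 * A * (T : ℝ) ^ (1 - κ)) := by
        have := sum_rpow_neg_le hκ0.le hκ1 T
        gcongr
    _ = _ := by ring
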